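/- Let $k\ge 2$ and $1\le j\le k-1$ be fixed integers. For $n\in\mathbb N$, assign to every $(k+1)$-element subset of $[n]=\{1,\dots,n\}$ independently a birth time chosen uniformly at random from $[0,1]$. For $p\in[0,1]$ let $\mathcal G_p$ be the simplicial complex on the vertex set $[n]$ whose simplices are all singletons $\{v\}$, $v\in[n]$, and all non-empty subsets of $(k+1)$-sets with birth time at most $p$; an $i$-simplex is a simplex with $i+1$ elements. A vertex $v$ is *isolated* if $\{v\}$ is the only simplex containing it. For $1\le i\le k-1$, a *copy of $M_i$* in a $k$-dimensional complex $\mathcal G$ is a triple $(K,C,J)$ such that 1. $K$ is a $k$-simplex of $\mathcal G$; 2. $C\subseteq K$ with $|C|=i$, and none of the sets (petals) $C\cup\{w\}$, $w\in K\setminus C$, is contained in a $k$-simplex of $\mathcal G$ other than $K$; 3. $J$ is an $i$-cycle in $\mathcal G$, i.e. a set of $i$-simplices of $\mathcal G$ such that every $(i-1)$-simplex is contained in an even number of elements of $J$, and $J$ contains exactly one of the petals $C\cup\{w\}$, $w\in K\setminus C$. Let $p_{M_j}:=\sup\{p\in[0,1] : \mathcal G_p \text{ contains a copy of } M_j\}$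 (with $\sup\emptyset=0$). Then, with probability tending to $1$ as $n\to\infty$, the following holds: for every $p\in[0,1]$ with $p<p_{M_j}$, the complex $\mathcal G_p$ contains an isolated vertex or a copy of $M_i$ for some $i\in\{1,\dots,j\}$. -/

import Mathlib

open Filter Topology MeasureTheory

namespace RandomComplex

section Complexes

variable {V : Type*}

/-- `B` is an `i`-simplex of the complex `G`, i.e. an element of `G` with `i + 1` vertices. -/
def IsSimplexOfDim (G : AbstractSimplicialComplex V) (i : ℕ) (B : Finset V) : Prop :=
  B ∈ G.faces ∧ B.card = i + 1

/-- The vertex `v` is isolated in `G`: the only simplex of `G` containing `v` is `{v}`. -/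
def IsIsolatedVertex (G : AbstractSimplicialComplex V) (v : V) : Prop :=
  ∀ B ∈ G.faces, v ∈ B → B = {v}

/-- The complex on the vertex set `V` generated by a set `E` of hyperedges: its simplices are all
singletons and all non-empty subsets of hyperedges. -/
def downwardClosure (E : Set (Finset V)) : AbstractSimplicialComplex V where
  faces := {A | (∃ v, A = {v}) ∨ (A.Nonempty ∧ ∃ B ∈ E, A ⊆ B)}
  isRelLowerSet_faces := by
    rintro A (⟨v, rfl⟩ | ⟨hA, B, hB, hAB⟩)
    · refine ⟨Finset.singleton_nonempty v, fun A' hA' hne => Or.inl ⟨v, ?_⟩⟩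
      exact (Finset.Nonempty.subset_singleton_iff hne).1 hA'
    · exact ⟨hA, fun A' hA' hne => Or.inr ⟨hne, B, hB, hA'.trans hAB⟩⟩
  singleton_mem := fun v => Or.inl ⟨v, rfl⟩

variable [DecidableEq V]

/-- The `j`-flower in `K` with centre `C` (where `C` has `j` elements): the set of its petals
`C ∪ {w}`, `w ∈ K \ C`. -/
def flower (K C : Finset V) : Finset (Finset V) :=
  (K \ C).image fun w => C ∪ {w}

/-- `J` is a `j`-cycle in `G`: a set of `j`-simplices of `G` such that every `(j-1)`-simplex of `G`
is contained in an even number of elements of `J`. A `(j-1)`-simplex has `j` vertices; this is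
used for `1 ≤ j`. -/
def IsCycle (G : AbstractSimplicialComplex V) (j : ℕ) (J : Finset (Finset V)) : Prop :=
  (∀ σ ∈ J, IsSimplexOfDim G j σ) ∧
    ∀ τ ∈ G.faces, τ.card = j → Even (J.filter fun σ => τ ⊆ σ).card

/-- The triple `(K, C, J)` is a copy of the minimal obstruction `M_j` in the `k`-complex `G`
(used for `1 ≤ j < k`). -/
structure IsCopyOfM (k j : ℕ) (G : AbstractSimplicialComplex V)
    (K C : Finset V) (J : Finset (Finset V)) : Prop where
  simplex : IsSimplexOfDim G k K
  centre_subset : C ⊆ K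
  centre_card : C.card = j
  petal_unique : ∀ P ∈ flower K C, ∀ K', IsSimplexOfDim G k K' → P ⊆ K' → K' = K
  cycle : IsCycle G j J
  one_petal : ∃ w₀ ∈ K \ C, J ∩ flower K C = {C ∪ {w₀}}

/-- The `k`-complex `G` contains a copy of `M_j`. -/
def ContainsM (k j : ℕ) (G : AbstractSimplicialComplex V) : Prop :=
  ∃ K C J, IsCopyOfM k j G K C J

end Complexes

/-- An assignment of a birth time in `[0, 1]` to each `(k+1)`-subset of the `n`-element vertex set.
The measure `volume` on this finite product is the product of the uniform distributions on `[0, 1]`,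
so that under it the birth times are independent and uniformly distributed on `[0, 1]`. -/
abbrev BirthTimes (k n : ℕ) : Type :=
  {K : Finset (Fin n) // K.card = k + 1} → unitInterval

/-- The random complex `G_p`, viewed as a process in `p`: the complex generated by the
`(k+1)`-sets with birth time at most `p`. -/
def randomComplex {k n : ℕ} (t : BirthTimes k n) (p : ℝ) : AbstractSimplicialComplex (Fin n) :=
  downwardClosure {B | ∃ h : B.card = k + 1, (t ⟨B, h⟩ : ℝ) ≤ p}

/-- `p_{M_j} = sup {p ∈ [0,1] | G_p contains a copy of M_j}`, where the supremum of the empty set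
(as a subset of `[0, 1]`) is `0`. -/
noncomputable def lastM {k n : ℕ} (j : ℕ) (t : BirthTimes k n) : ℝ :=
  sSup {p : ℝ | p ∈ Set.Icc (0 : ℝ) 1 ∧ ContainsM k j (randomComplex t p)}

/-- The property `A` of the birth times holds with high probability: the probability that it fails
tends to `0` as `n → ∞`. (If `A n` is not measurable, the measure of its complement is the
outer measure, so that `A n` contains a measurable event of probability tending to `1`.) -/
def WithHighProbability (k : ℕ) (A : ∀ n : ℕ, Set (BirthTimes k n)) : Prop :=
  Tendsto (fun n => (volume : Measure (BirthTimes k n)) (A n)ᶜ) atTop (𝓝 0)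

end RandomComplex

open Filter Topology MeasureTheory

namespace RandomComplex

/-! ### Crossing cycles and linear algebra over 𝔽₂ -/

section Deterministic

variable {V : Type*} [DecidableEq V]

/-! Call the rivals of a flower `(K, C)` the other cells that contain one of its petals, and write
`L_i = numRivals k n i`, of order `n^(k-i)`, for their number when `|C| = i`. If `K` is born by time
`a`, all rivals are born after `b`, and a cycle crosses the flower in exactly one petal at time `a`,
then `(K, C)` gives a copy of `M_i` throughout `[a, b]`, because cycles persist as the complex grows
(`containsM_of_survives`). Thus boundedly many such pairs suffice to cover the time axis up to the
end of phase `j`.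

Phase `0` ends at `log n / (4 n^k)`, while isolated vertices still exist. Phase `i ≥ 1` ends at
`((i+1) log n + ½ log log n) / L_i`. A second moment argument gives many cells born by `a` with
rivals unborn until `b`; what remains is to see that most of them have a crossing cycle. This is
deterministic: without a crossing cycle, duality over 𝔽₂ yields a function on `i`-sets whose
coboundary is nonzero and supported in the flower, and for cells with private petals these functions
are linearly independent. So at any time at most `n.choose i` such cells lack a crossing cycle
(`card_le_choose_of_not_hasCrossingCycle`). Whether a cell is of this kind is decided by the cells
born by `a`, so survival of its rivals from `a` to `b` is independent of it and costs the usual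
factor; the bad survivors are therefore outnumbered (`withHighProbability_survivor`).

After the end of phase `j`, with high probability no cell is born before all rivals of one of its
flowers with a centre of size `j`, and every `(j+1)`-subset of a cell is the base of a cone whose
boundary supplies a crossing cycle. Hence the cell of a copy of `M_j` seen at some later time `q`
was already born when phase `j` ended, and gives a copy at every time between
(`withHighProbability_final`). -/

theorem mem_flower {K C P : Finset V} : P ∈ flower K C ↔ ∃ w ∈ K \ C, C ∪ {w} = P := by
  simp [flower]

/-- An `(j-1)`-simplex of the larger complex either lies in an element of `J`, and is then already a
face of `G`, or lies in none, and the count is zero. -/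
theorem IsCycle.mono {G G' : AbstractSimplicialComplex V} (h : G.faces ⊆ G'.faces) {j : ℕ}
    {J : Finset (Finset V)} (hJ : IsCycle G j J) : IsCycle G' j J := by
  refine ⟨fun σ hσ => ⟨h (hJ.1 σ hσ).1, (hJ.1 σ hσ).2⟩, fun τ hτ hc => ?_⟩
  by_cases hex : ∃ σ ∈ J, τ ⊆ σ
  · obtain ⟨σ, hσ, hτσ⟩ := hex
    exact hJ.2 τ (G.isRelLowerSet_faces.mem_of_le (hJ.1 σ hσ).1 hτσ
      (G'.isRelLowerSet_faces.prop_of_mem hτ)) hc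
  · rw [Finset.filter_eq_empty_iff.2 (fun σ hσ hs => hex ⟨σ, hσ, hs⟩)]
    simp

/-- The pair `(K, C)` admits a cycle that meets its flower in exactly one petal. -/
def HasCrossingCycle (G : AbstractSimplicialComplex V) (i : ℕ) (K C : Finset V) : Prop :=
  ∃ J, IsCycle G i J ∧ ∃ w₀ ∈ K \ C, J ∩ flower K C = {C ∪ {w₀}}

theorem HasCrossingCycle.mono {G G' : AbstractSimplicialComplex V} (h : G.faces ⊆ G'.faces)
    {i : ℕ} {K C : Finset V} (hJ : HasCrossingCycle G i K C) : HasCrossingCycle G' i K C := by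
  obtain ⟨J, hJ, hw⟩ := hJ
  exact ⟨J, hJ.mono h, hw⟩

/-- The coboundary map with coefficients in `𝔽₂`, from functions on `i`-sets to functions on
the `i`-simplices of `G`. -/
noncomputable def coboundary [Fintype V] (G : AbstractSimplicialComplex V) (i : ℕ) :
    ({τ : Finset V // τ.card = i} → ZMod 2) →ₗ[ZMod 2]
      ({σ : Finset V // IsSimplexOfDim G i σ} → ZMod 2) :=
  Matrix.mulVecLin (Matrix.of fun σ τ => if τ.1 ⊆ σ.1 then 1 else 0)

theorem coboundary_single [Fintype V] (G : AbstractSimplicialComplex V) (i : ℕ)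
    (τ : {τ : Finset V // τ.card = i}) (σ : {σ : Finset V // IsSimplexOfDim G i σ}) :
    coboundary G i (Pi.single τ 1) σ = if τ.1 ⊆ σ.1 then 1 else 0 := by
  simp [coboundary]

/-- If no cycle meets the flower of `(K, C)` in exactly one petal, then some coboundary is
supported in the flower without vanishing. -/
theorem exists_coboundary_of_not_hasCrossingCycle [Fintype V] {G : AbstractSimplicialComplex V}
    {i : ℕ} {K C : Finset V} (hK : K ∈ G.faces) (hCK : C ⊆ K) (hC : C.card = i) {w₀ : V}
    (hw₀ : w₀ ∈ K \ C) (hJ : ¬ HasCrossingCycle G i K C) :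
    ∃ g, (∃ σ, σ.1 = C ∪ {w₀} ∧ coboundary G i g σ ≠ 0) ∧
      ∀ σ, coboundary G i g σ ≠ 0 → σ.1 ∈ flower K C := by
  classical
  have hw := Finset.mem_sdiff.1 hw₀
  have hσ₀ : IsSimplexOfDim G i (C ∪ {w₀}) := by
    refine ⟨G.isRelLowerSet_faces.mem_of_le hK
      (Finset.union_subset hCK (Finset.singleton_subset_iff.2 hw.1)) (by simp), ?_⟩
    rw [Finset.card_union_of_disjoint (Finset.disjoint_singleton_right.2 hw.2), hC]
    simp
  set σ₀ : {σ : Finset V // IsSimplexOfDim G i σ} := ⟨_, hσ₀⟩ with hσ₀_def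
  -- `W` consists of the functions supported on the petals other than `σ₀`. If the indicator of `σ₀`
  -- is a coboundary plus an element of `W`, that coboundary is as required; otherwise a separating
  -- functional yields a crossing cycle.
  let W : Submodule (ZMod 2) ({σ : Finset V // IsSimplexOfDim G i σ} → ZMod 2) :=
    { carrier := {f | ∀ σ, (σ.1 ∉ flower K C ∨ σ = σ₀) → f σ = 0}
      add_mem' := fun {a b} ha hb σ h => by simp [ha σ h, hb σ h]
      zero_mem' := fun σ _ => rfl
      smul_mem' := fun c f hf σ h => by simp [hf σ h] }
  by_cases hmem : (Pi.single σ₀ 1 : {σ : Finset V // IsSimplexOfDim G i σ} → ZMod 2) ∈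
      LinearMap.range (coboundary G i) ⊔ W
  · obtain ⟨y, ⟨g, rfl⟩, z, hz, hyz⟩ := Submodule.mem_sup.1 hmem
    have key : ∀ σ, coboundary G i g σ = (Pi.single σ₀ 1 : _ → ZMod 2) σ - z σ := by
      intro σ
      rw [← hyz]
      simp
    refine ⟨g, ⟨σ₀, rfl, ?_⟩, fun σ hσ => ?_⟩
    · rw [key, hz σ₀ (Or.inr rfl)]
      simp
    · by_contra hσf
      have hne : σ ≠ σ₀ := by
        rintro rfl
        exact hσf (mem_flower.2 ⟨w₀, hw₀, rfl⟩)
      rw [key, hz σ (Or.inl hσf)] at hσ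
      simp [hne] at hσ
  · exfalso
    apply hJ
    -- The cycle is the support of `φ`. Vanishing on the coboundary of the indicator of `τ` says
    -- that evenly many elements of the support contain `τ`; vanishing on `W` excludes all petals
    -- but `σ₀`.
    obtain ⟨φ, hφ, hle⟩ := Submodule.exists_le_ker_of_notMem hmem
    have hval : ∀ x : ZMod 2, x ≠ 0 → x = 1 := by decide
    refine ⟨(Finset.univ.filter fun σ => φ (Pi.single σ 1) ≠ 0).map
      (Function.Embedding.subtype _), ⟨?_, ?_⟩, w₀, hw₀, ?_⟩
    · intro σ hσ
      simp only [Finset.mem_map, Function.Embedding.coe_subtype] at hσ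
      obtain ⟨σ', -, rfl⟩ := hσ
      exact σ'.2
    · intro τ _ hτ
      have h0 : φ (coboundary G i (Pi.single ⟨τ, hτ⟩ 1)) = 0 :=
        hle (Submodule.mem_sup_left ⟨_, rfl⟩)
      rw [pi_eq_sum_univ' (coboundary G i (Pi.single ⟨τ, hτ⟩ 1)), map_sum] at h0
      simp only [map_smul, coboundary_single] at h0
      rw [Finset.filter_map, Finset.card_map, Finset.filter_filter]
      rw [even_iff_two_dvd, ← ZMod.natCast_eq_zero_iff, Finset.card_filter, Nat.cast_sum]
      refine Eq.trans (Finset.sum_congr rfl fun σ _ => ?_) h0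
      by_cases h1 : φ (Pi.single σ 1) = 0
      · simp [h1]
      · simp [hval _ h1]
    · ext P
      simp only [Finset.mem_inter, Finset.mem_map, Function.Embedding.coe_subtype,
        Finset.mem_filter, Finset.mem_univ, true_and, Finset.mem_singleton]
      constructor
      · rintro ⟨⟨σ, hσ, rfl⟩, hP⟩
        by_contra hne
        refine hσ (hle (Submodule.mem_sup_right ?_))
        rintro σ' (h' | rfl)
        · rw [Pi.single_apply, if_neg]
          rintro rfl
          exact h' hP
        · rw [Pi.single_apply, if_neg]
          rintro rfl
          exact hne rfl
      · rintro rfl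
        exact ⟨⟨σ₀, hφ, rfl⟩, mem_flower.2 ⟨w₀, hw₀, rfl⟩⟩

/-- Simplices with private petals that admit no crossing cycle are at most as numerous as the
`i`-subsets of the vertex set. -/
theorem card_le_choose_of_not_hasCrossingCycle [Fintype V] {G : AbstractSimplicialComplex V}
    {i : ℕ} (c : Finset V → Finset V) (S : Finset (Finset V))
    (hS : ∀ K ∈ S, K ∈ G.faces) (hcK : ∀ K ∈ S, c K ⊂ K) (hc : ∀ K ∈ S, (c K).card = i)
    (hpetal : ∀ K ∈ S, ∀ P ∈ flower K (c K), ∀ K' ∈ S, P ⊆ K' → K' = K)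
    (hJ : ∀ K ∈ S, ¬ HasCrossingCycle G i K (c K)) :
    S.card ≤ (Fintype.card V).choose i := by
  classical
  have hw : ∀ K : S, ∃ w, w ∈ K.1 \ c K.1 := fun K => by
    obtain ⟨w, h⟩ := Finset.exists_of_ssubset (hcK K.1 K.2)
    exact ⟨w, Finset.mem_sdiff.2 h⟩
  choose w hw using hw
  have := fun K : S => exists_coboundary_of_not_hasCrossingCycle (hS K.1 K.2)
    (hcK K.1 K.2).subset (hc K.1 K.2) (hw K) (hJ K.1 K.2)
  choose g hg hsupp using this
  choose σ hσ hne using hg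
  -- Evaluating a relation among the coboundaries at the petal `σ K` isolates the coefficient of
  -- `K`: if the coboundary of `g K'` is nonzero there, then `σ K` is also a petal of `K'` lying in
  -- `K`, and privacy forces `K = K'`.
  have hli : LinearIndependent (ZMod 2) g := by
    apply LinearIndependent.of_comp (coboundary G i)
    rw [linearIndependent_iff']
    intro s a hs K hK
    have h := congrFun hs (σ K)
    rw [Finset.sum_apply, Finset.sum_eq_single_of_mem K hK] at h
    · simpa [hne K] using h
    · intro K' _ hK'
      by_contra h0
      have h1 : coboundary G i (g K') (σ K) ≠ 0 := by
        intro h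
        apply h0
        simp [h]
      have h2 := hsupp K' _ h1
      have h3 : (σ K).1 ⊆ K.1 := by
        rw [hσ]
        exact Finset.union_subset (hcK K.1 K.2).subset
          (Finset.singleton_subset_iff.2 (Finset.mem_sdiff.1 (hw K)).1)
      exact hK' (Subtype.ext (hpetal K'.1 K'.2 _ h2 K.1 K.2 h3).symm)
  have h := hli.fintype_card_le_finrank
  simpa using h

/-- The boundary of the simplex on `S ∪ {a}`, where `S` is a petal and `a ∉ K`, crosses the flower
exactly once. -/
theorem hasCrossingCycle_of_cone {G : AbstractSimplicialComplex V} {i : ℕ} {K C : Finset V}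
    (hK : K ∈ G.faces) (hCK : C ⊂ K) (hC : C.card = i)
    (h : ∀ S ⊆ K, S.card = i + 1 → ∃ a ∉ K, ∀ T ⊆ S, T.card = i → insert a T ∈ G.faces) :
    HasCrossingCycle G i K C := by
  obtain ⟨w₀, hw₀K, hw₀C⟩ := Finset.exists_of_ssubset hCK
  have hSK : C ∪ {w₀} ⊆ K :=
    Finset.union_subset hCK.subset (Finset.singleton_subset_iff.2 hw₀K)
  have hS : (C ∪ {w₀}).card = i + 1 := by
    rw [Finset.card_union_of_disjoint (Finset.disjoint_singleton_right.2 hw₀C), hC]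
    simp
  obtain ⟨a, haK, ha⟩ := h _ hSK hS
  have haS : a ∉ C ∪ {w₀} := fun h => haK (hSK h)
  refine ⟨(insert a (C ∪ {w₀})).powersetCard (i + 1), ⟨?_, ?_⟩, w₀,
    Finset.mem_sdiff.2 ⟨hw₀K, hw₀C⟩, ?_⟩
  · intro σ hσ
    rw [Finset.mem_powersetCard] at hσ
    refine ⟨?_, hσ.2⟩
    by_cases haσ : a ∈ σ
    · have := ha (σ.erase a) (by
        intro x hx
        exact (Finset.mem_insert.1 (hσ.1 (Finset.mem_of_mem_erase hx))).resolve_left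
          (Finset.ne_of_mem_erase hx)) (by rw [Finset.card_erase_of_mem haσ, hσ.2]; simp)
      rwa [Finset.insert_erase haσ] at this
    · refine G.isRelLowerSet_faces.mem_of_le hK (le_trans ?_ hSK) ?_
      · intro x hx
        exact (Finset.mem_insert.1 (hσ.1 hx)).resolve_left (by rintro rfl; exact haσ hx)
      · rw [← Finset.card_pos, hσ.2]
        omega
  · intro τ _ hτ
    by_cases hsub : τ ⊆ insert a (C ∪ {w₀})
    · have : ((insert a (C ∪ {w₀})).powersetCard (i + 1)).filter (fun σ => τ ⊆ σ) =
          (insert a (C ∪ {w₀}) \ τ).image fun x => insert x τ := by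
        ext σ
        simp only [Finset.mem_filter, Finset.mem_powersetCard, Finset.mem_image,
          Finset.mem_sdiff]
        constructor
        · rintro ⟨⟨h1, h2⟩, h3⟩
          obtain ⟨x, hx⟩ := Finset.card_eq_one.1 (show (σ \ τ).card = 1 by
            rw [Finset.card_sdiff_of_subset h3, h2, hτ]; simp)
          have hx' : x ∈ σ \ τ := by rw [hx]; simp
          rw [Finset.mem_sdiff] at hx'
          refine ⟨x, ⟨h1 hx'.1, hx'.2⟩, ?_⟩
          rw [← Finset.sdiff_union_of_subset h3, hx]
          rfl
        · rintro ⟨x, ⟨hx1, hx2⟩, rfl⟩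
          refine ⟨⟨Finset.insert_subset hx1 hsub, ?_⟩, Finset.subset_insert _ _⟩
          rw [Finset.card_insert_of_notMem hx2, hτ]
      rw [this, Finset.card_image_of_injOn, Finset.card_sdiff_of_subset hsub,
        Finset.card_insert_of_notMem haS, hS, hτ]
      · rw [show i + 1 + 1 - i = 2 by omega]
        exact even_two
      · intro x hx y hy hxy
        simp only [Finset.coe_sdiff, Set.mem_sdiff, Finset.mem_coe] at hx hy
        have : x ∈ insert y τ := by
          rw [← show insert x τ = insert y τ from hxy]
          simp
        exact (Finset.mem_insert.1 this).resolve_right hx.2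
    · rw [Finset.filter_eq_empty_iff.2]
      · simp
      · intro σ hσ hτσ
        exact hsub (hτσ.trans (Finset.mem_powersetCard.1 hσ).1)
  · ext P
    simp only [Finset.mem_inter, Finset.mem_powersetCard, mem_flower, Finset.mem_singleton]
    constructor
    · rintro ⟨⟨h1, h2⟩, w, hw, rfl⟩
      have : w ∈ insert a (C ∪ {w₀}) := h1 (by simp)
      rw [Finset.mem_sdiff] at hw
      simp only [Finset.mem_insert, Finset.mem_union, Finset.mem_singleton] at this
      rcases this with rfl | h | rfl
      · exact absurd hw.1 haK
      · exact absurd h hw.2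
      · rfl
    · rintro rfl
      exact ⟨⟨Finset.subset_insert _ _, hS⟩, w₀, Finset.mem_sdiff.2 ⟨hw₀K, hw₀C⟩, rfl⟩

end Deterministic

end RandomComplex

namespace RandomComplex

/-! ### Second moment bound and product measure computations -/

section Probability

/-- A second moment bound: if the events `X α` are nearly pairwise independent and the events `Y α`
are rare in comparison, then `X α ⊆ Y α` for all `α` only with small probability. -/
theorem measureReal_forall_imp_le {Ω ι : Type*} [MeasurableSpace Ω] (ℙ : Measure Ω)
    [IsProbabilityMeasure ℙ] (s : Finset ι) (X Y : ι → Set Ω)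
    (hX : ∀ α ∈ s, MeasurableSet (X α)) (hY : ∀ α ∈ s, MeasurableSet (Y α)) {η μ y : ℝ}
    (hη : 0 ≤ η) (hμ : 0 < μ) (hXμ : ∑ α ∈ s, ℙ.real (X α) = μ)
    (hYy : ∑ α ∈ s, ℙ.real (Y α) ≤ y)
    (hpair : ∀ α ∈ s, ∀ β ∈ s, α ≠ β →
      ℙ.real (X α ∩ X β) ≤ (1 + η) * (ℙ.real (X α) * ℙ.real (X β))) :
    ℙ.real {ω | ∀ α ∈ s, ω ∈ X α → ω ∈ Y α} ≤ 4 / μ + 4 * η + 2 * y / μ := by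
  classical
  set x : Ω → ℝ := fun ω => ∑ α ∈ s, (X α).indicator (fun _ => (1 : ℝ)) ω with hx_def
  set z : Ω → ℝ := fun ω => ∑ α ∈ s, (Y α).indicator (fun _ => (1 : ℝ)) ω with hz_def
  have hint : ∀ A : Set Ω, MeasurableSet A → Integrable (A.indicator (fun _ => (1 : ℝ))) ℙ :=
    fun A hA => (integrable_const _).indicator hA
  have hval : ∀ A : Set Ω, MeasurableSet A → ∫ ω, A.indicator (fun _ => (1 : ℝ)) ω ∂ℙ = ℙ.real A :=
    fun A hA => by rw [integral_indicator hA]; simp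
  have hxi : Integrable x ℙ := integrable_finsetSum _ fun α hα => hint _ (hX α hα)
  have hzi : Integrable z ℙ := integrable_finsetSum _ fun α hα => hint _ (hY α hα)
  have hxv : ∫ ω, x ω ∂ℙ = μ := by
    rw [← hXμ, integral_finsetSum _ fun α hα => hint _ (hX α hα)]
    exact Finset.sum_congr rfl fun α hα => hval _ (hX α hα)
  have hzv : ∫ ω, z ω ∂ℙ ≤ y := by
    rw [integral_finsetSum _ fun α hα => hint _ (hY α hα)]
    exact (Finset.sum_congr rfl fun α hα => hval _ (hY α hα)).trans_le hYy
  have hxx : ∀ ω, x ω ^ 2 =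
      ∑ α ∈ s, ∑ β ∈ s, (X α ∩ X β).indicator (fun _ => (1 : ℝ)) ω := by
    intro ω
    rw [sq, Finset.sum_mul_sum]
    refine Finset.sum_congr rfl fun α _ => Finset.sum_congr rfl fun β _ => ?_
    by_cases h1 : ω ∈ X α <;> by_cases h2 : ω ∈ X β <;> simp [h1, h2]
  have hxxi : Integrable (fun ω => x ω ^ 2) ℙ := by
    simp_rw [hxx]
    exact integrable_finsetSum _ fun α hα => integrable_finsetSum _ fun β hβ =>
      hint _ ((hX α hα).inter (hX β hβ))
  have hxxv : ∫ ω, x ω ^ 2 ∂ℙ ≤ μ + (1 + η) * μ ^ 2 := by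
    simp_rw [hxx]
    rw [integral_finsetSum _ fun α hα => integrable_finsetSum _ fun β hβ =>
      hint _ ((hX α hα).inter (hX β hβ))]
    have hle : ∀ α ∈ s, ∫ ω, ∑ β ∈ s, (X α ∩ X β).indicator (fun _ => (1 : ℝ)) ω ∂ℙ ≤
        ℙ.real (X α) + (1 + η) * (ℙ.real (X α) * μ) := by
      intro α hα
      rw [integral_finsetSum _ fun β hβ => hint _ ((hX α hα).inter (hX β hβ)),
        Finset.sum_congr rfl fun β hβ => hval _ ((hX α hα).inter (hX β hβ)),
        ← Finset.add_sum_erase _ _ hα, Set.inter_self, ← hXμ, Finset.mul_sum, Finset.mul_sum]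
      refine add_le_add le_rfl ((Finset.sum_le_sum fun β hβ => hpair α hα β
        (Finset.mem_of_mem_erase hβ) (Finset.ne_of_mem_erase hβ).symm).trans ?_)
      refine Finset.sum_le_sum_of_subset_of_nonneg (Finset.erase_subset _ _) fun β _ _ => ?_
      positivity
    refine (Finset.sum_le_sum hle).trans (le_of_eq ?_)
    rw [Finset.sum_add_distrib, ← Finset.mul_sum, ← Finset.sum_mul, hXμ]
    ring
  -- Chebyshev for `x` and Markov for `z` are merged into one Markov inequality. If `x ≤ z`, then `x
  -- ≤ μ / 2` or `z ≥ μ / 2`, and either way this function is at least `1`.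
  have hfi : Integrable (fun ω => 4 / μ ^ 2 * (x ω - μ) ^ 2 + 2 / μ * z ω) ℙ := by
    have : (fun ω => 4 / μ ^ 2 * (x ω - μ) ^ 2 + 2 / μ * z ω) =
        fun ω => 4 / μ ^ 2 * (x ω ^ 2 - 2 * μ * x ω + μ ^ 2) + 2 / μ * z ω := by
      funext ω
      ring
    rw [this]
    exact (((hxxi.sub (hxi.const_mul _)).add (integrable_const _)).const_mul _).add
      (hzi.const_mul _)
  have hfv : ∫ ω, (4 / μ ^ 2 * (x ω - μ) ^ 2 + 2 / μ * z ω) ∂ℙ ≤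
      4 / μ + 4 * η + 2 * y / μ := by
    have h1 : ∫ ω, (4 / μ ^ 2 * (x ω - μ) ^ 2 + 2 / μ * z ω) ∂ℙ =
        ∫ ω, (4 / μ ^ 2 * x ω ^ 2 - 8 / μ * x ω + (4 + 2 / μ * z ω)) ∂ℙ := by
      congr 1
      funext ω
      field_simp
      ring
    have i1 : Integrable (fun ω => 4 / μ ^ 2 * x ω ^ 2) ℙ := hxxi.const_mul _
    have i2 : Integrable (fun ω => 8 / μ * x ω) ℙ := hxi.const_mul _
    have i3 : Integrable (fun ω => 2 / μ * z ω) ℙ := hzi.const_mul _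
    have i4 : Integrable (fun ω => 4 / μ ^ 2 * x ω ^ 2 - 8 / μ * x ω) ℙ := i1.sub i2
    have i5 : Integrable (fun ω => 4 + 2 / μ * z ω) ℙ := (integrable_const _).add i3
    rw [h1, integral_add i4 i5, integral_sub i1 i2, integral_add (integrable_const _) i3,
      integral_const_mul, integral_const_mul, integral_const_mul, hxv, integral_const]
    have h2 : 4 / μ ^ 2 * ∫ ω, x ω ^ 2 ∂ℙ ≤ 4 / μ ^ 2 * (μ + (1 + η) * μ ^ 2) :=
      mul_le_mul_of_nonneg_left hxxv (by positivity)
    have h3 : 2 / μ * ∫ ω, z ω ∂ℙ ≤ 2 / μ * y := mul_le_mul_of_nonneg_left hzv (by positivity)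
    have h4 : 4 / μ ^ 2 * (μ + (1 + η) * μ ^ 2) = 4 / μ + 4 + 4 * η := by
      field_simp
      ring
    have h5 : 8 / μ * μ = 8 := by field_simp
    have h6 : 2 / μ * y = 2 * y / μ := by ring
    simp only [probReal_univ, smul_eq_mul]
    linarith
  have hz0 : ∀ ω, 0 ≤ z ω := fun ω =>
    Finset.sum_nonneg fun α _ => Set.indicator_nonneg (fun _ _ => zero_le_one) _
  refine le_trans ?_ hfv
  have h := mul_meas_ge_le_integral_of_nonneg (μ := ℙ) (Filter.Eventually.of_forall fun ω => by
    have := hz0 ω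
    positivity) hfi 1
  rw [one_mul] at h
  refine (measureReal_mono ?_).trans h
  intro ω hω
  have hxz : x ω ≤ z ω := by
    refine Finset.sum_le_sum fun α hα => ?_
    by_cases h1 : ω ∈ X α
    · simp [h1, hω α hα h1]
    · rw [Set.indicator_of_notMem h1]
      exact Set.indicator_nonneg (fun _ _ => zero_le_one) _
  rw [Set.mem_ofPred_eq]
  by_cases hhalf : x ω ≤ μ / 2
  · have h1 : μ ^ 2 / 4 ≤ (x ω - μ) ^ 2 := by nlinarith
    have h2 : 4 / μ ^ 2 * (μ ^ 2 / 4) = 1 := by field_simp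
    have h3 := mul_le_mul_of_nonneg_left h1 (show 0 ≤ 4 / μ ^ 2 by positivity)
    have h4 : 0 ≤ 2 / μ * z ω := mul_nonneg (by positivity) (hz0 ω)
    linarith
  · have h1 : μ / 2 ≤ z ω := by linarith
    have h2 := mul_le_mul_of_nonneg_left h1 (show 0 ≤ 2 / μ by positivity)
    have h3 : 2 / μ * (μ / 2) = 1 := by field_simp
    have h4 : 0 ≤ 4 / μ ^ 2 * (x ω - μ) ^ 2 := by positivity
    linarith

theorem measureReal_unitInterval_le {a : ℝ} (h0 : 0 ≤ a) (h1 : a ≤ 1) :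
    (volume : Measure unitInterval).real {x | (x : ℝ) ≤ a} = a := by
  have : {x : unitInterval | (x : ℝ) ≤ a} = Set.Iic ⟨a, h0, h1⟩ := by
    ext x
    simp [← Subtype.coe_le_coe]
  rw [this, measureReal_def, unitInterval.volume_Iic, ENNReal.toReal_ofReal h0]

theorem measureReal_unitInterval_gt {a : ℝ} (h0 : 0 ≤ a) (h1 : a ≤ 1) :
    (volume : Measure unitInterval).real {x | a < (x : ℝ)} = 1 - a := by
  have : {x : unitInterval | a < (x : ℝ)} = Set.Ioi ⟨a, h0, h1⟩ := by
    ext x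
    simp [← Subtype.coe_lt_coe]
  rw [this, measureReal_def, unitInterval.volume_Ioi, ENNReal.toReal_ofReal (sub_nonneg.2 h1)]

theorem measureReal_unitInterval_Ioc_le {u v : ℝ} (huv : u ≤ v) :
    (volume : Measure unitInterval).real {x | u < (x : ℝ) ∧ (x : ℝ) ≤ v} ≤ v - u := by
  rw [measureReal_def, unitInterval.volume_apply]
  refine ENNReal.toReal_le_of_le_ofReal (sub_nonneg.2 huv) ?_
  rw [← Real.volume_Ioc]
  refine measure_mono ?_
  rintro _ ⟨x, hx, rfl⟩
  exact hx

variable {ι : Type*}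

/-- The coordinates in `A` are at most `a` and the coordinates in `B` are greater than `b`. -/
def lowHigh (A B : Finset ι) (a b : ℝ) : Set (ι → unitInterval) :=
  {t | (∀ x ∈ A, (t x : ℝ) ≤ a) ∧ ∀ x ∈ B, b < (t x : ℝ)}

theorem measurableSet_le_coe (a : ℝ) : MeasurableSet {x : unitInterval | (x : ℝ) ≤ a} :=
  measurableSet_le measurable_subtype_coe measurable_const

theorem measurableSet_lt_coe (a : ℝ) : MeasurableSet {x : unitInterval | a < (x : ℝ)} :=
  measurableSet_lt measurable_const measurable_subtype_coe

theorem measurableSet_lowHigh (A B : Finset ι) (a b : ℝ) : MeasurableSet (lowHigh A B a b) := by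
  have : lowHigh A B a b = (⋂ x ∈ A, (fun t : ι → unitInterval => t x) ⁻¹' {x | (x : ℝ) ≤ a}) ∩
      ⋂ x ∈ B, (fun t : ι → unitInterval => t x) ⁻¹' {x | b < (x : ℝ)} := by
    ext t
    simp [lowHigh]
  rw [this]
  exact (Finset.measurableSet_biInter _ fun x _ =>
      (measurable_pi_apply x) (measurableSet_le_coe a)).inter
    (Finset.measurableSet_biInter _ fun x _ => (measurable_pi_apply x) (measurableSet_lt_coe b))

variable [Fintype ι]

theorem measureReal_box (s : ι → Set unitInterval) :
    (volume : Measure (ι → unitInterval)).real {t | ∀ x, t x ∈ s x} =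
      ∏ x, (volume : Measure unitInterval).real (s x) := by
  have : {t : ι → unitInterval | ∀ x, t x ∈ s x} = Set.univ.pi s := by
    ext t
    simp
  rw [this, measureReal_def, volume_pi, Measure.pi_pi, ENNReal.toReal_prod]
  rfl

theorem measureReal_lowHigh {A B : Finset ι} (hAB : Disjoint A B) {a b : ℝ} (ha0 : 0 ≤ a)
    (ha1 : a ≤ 1) (hb0 : 0 ≤ b) (hb1 : b ≤ 1) :
    (volume : Measure (ι → unitInterval)).real (lowHigh A B a b) =
      a ^ A.card * (1 - b) ^ B.card := by
  classical
  have : lowHigh A B a b = {t : ι → unitInterval | ∀ x, t x ∈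
      if x ∈ A then {x : unitInterval | (x : ℝ) ≤ a} else
        if x ∈ B then {x : unitInterval | b < (x : ℝ)} else Set.univ} := by
    ext t
    constructor
    · intro h x
      split_ifs with h1 h2
      · exact h.1 x h1
      · exact h.2 x h2
      · trivial
    · intro h
      refine ⟨fun x hx => ?_, fun x hx => ?_⟩
      · simpa [hx] using h x
      · simpa [hx, Finset.disjoint_right.1 hAB hx] using h x
  rw [this, measureReal_box]
  have h : ∀ x, (volume : Measure unitInterval).real
      (if x ∈ A then {x : unitInterval | (x : ℝ) ≤ a} else
        if x ∈ B then {x : unitInterval | b < (x : ℝ)} else Set.univ) =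
      (if x ∈ A then a else 1) * if x ∈ B then 1 - b else 1 := by
    intro x
    by_cases h1 : x ∈ A
    · simp [h1, Finset.disjoint_left.1 hAB h1, measureReal_unitInterval_le ha0 ha1]
    · by_cases h2 : x ∈ B
      · simp [h1, h2, measureReal_unitInterval_gt hb0 hb1]
      · simp [h1, h2]
  simp_rw [h]
  rw [Finset.prod_mul_distrib, Finset.prod_ite_mem, Finset.prod_ite_mem]
  simp

/-- The set of coordinates that are at most `a`. -/
noncomputable def bornBy (t : ι → unitInterval) (a : ℝ) : Finset ι :=
  Finset.univ.filter fun x => (t x : ℝ) ≤ a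

theorem mem_bornBy {t : ι → unitInterval} {a : ℝ} {x : ι} : x ∈ bornBy t a ↔ (t x : ℝ) ≤ a := by
  simp [bornBy]

theorem setOf_bornBy_eq [DecidableEq ι] (H : Finset ι) (a : ℝ) :
    {t : ι → unitInterval | bornBy t a = H} = lowHigh H Hᶜ a a := by
  ext t
  simp only [Set.mem_ofPred_eq, Finset.ext_iff, mem_bornBy, lowHigh, Finset.mem_compl]
  constructor
  · intro h
    exact ⟨fun x hx => (h x).2 hx, fun x hx => not_le.1 fun h' => hx ((h x).1 h')⟩
  · intro h x
    exact ⟨fun h' => by_contra fun hx => (h.2 x hx).not_ge h', h.1 x⟩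

theorem measurableSet_bornBy (P : Finset ι → Prop) (a : ℝ) :
    MeasurableSet {t : ι → unitInterval | P (bornBy t a)} := by
  classical
  have : {t : ι → unitInterval | P (bornBy t a)} =
      ⋃ H ∈ (Finset.univ.filter P : Finset (Finset ι)), {t | bornBy t a = H} := by
    ext t
    simp
  rw [this]
  refine Finset.measurableSet_biUnion _ fun H _ => ?_
  rw [setOf_bornBy_eq]
  exact measurableSet_lowHigh _ _ _ _

theorem measureReal_bornBy_inter [DecidableEq ι] (P : Finset ι → Prop) [DecidablePred P] (a : ℝ)
    {E : Set (ι → unitInterval)} (hE : MeasurableSet E) :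
    (volume : Measure (ι → unitInterval)).real ({t | P (bornBy t a)} ∩ E) =
      ∑ H ∈ Finset.univ.filter P,
        (volume : Measure (ι → unitInterval)).real ({t | bornBy t a = H} ∩ E) := by
  rw [← measureReal_biUnion_finset]
  · congr 1
    ext t
    simp
  · intro H _ H' _ hne
    rw [Function.onFun, Set.disjoint_left]
    rintro t ⟨h1, -⟩ ⟨h2, -⟩
    exact hne (h1.symm.trans h2)
  · intro H _
    exact (measurableSet_bornBy (fun H' => H' = H) a).inter hE

/-- Conditionally on the coordinates born by time `a`, the coordinates of a set of unborn ones
survive up to time `b` independently. -/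
theorem measureReal_bornBy_survive (P : Finset ι → Prop) (B : Finset ι)
    (hP : ∀ H, P H → Disjoint H B) {a b : ℝ} (ha0 : 0 ≤ a) (hab : a ≤ b) (hb1 : b ≤ 1) :
    (volume : Measure (ι → unitInterval)).real
        ({t | P (bornBy t a)} ∩ {t | ∀ x ∈ B, b < (t x : ℝ)}) * (1 - a) ^ B.card =
      (volume : Measure (ι → unitInterval)).real {t | P (bornBy t a)} * (1 - b) ^ B.card := by
  classical
  have hB : MeasurableSet {t : ι → unitInterval | ∀ x ∈ B, b < (t x : ℝ)} := by
    simpa [lowHigh] using measurableSet_lowHigh (∅ : Finset ι) B a b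
  have huniv : {t : ι → unitInterval | P (bornBy t a)} = {t | P (bornBy t a)} ∩ Set.univ := by simp
  rw [measureReal_bornBy_inter P a hB, huniv, measureReal_bornBy_inter P a MeasurableSet.univ,
    Finset.sum_mul, Finset.sum_mul]
  -- For a fixed set `H` of born coordinates both events are boxes, and they differ only in that the
  -- coordinates in `B` exceed `b` instead of `a`.
  refine Finset.sum_congr rfl fun H hH => ?_
  have hd := hP H (Finset.mem_filter.1 hH).2
  have ha1 := hab.trans hb1
  have hb0 := ha0.trans hab
  have hBH : B ⊆ Hᶜ := fun x hx => Finset.mem_compl.2 (Finset.disjoint_right.1 hd hx)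
  rw [Set.inter_univ, setOf_bornBy_eq, measureReal_lowHigh disjoint_compl_right ha0 ha1 ha0 ha1]
  have hbox : lowHigh H Hᶜ a a ∩ {t : ι → unitInterval | ∀ x ∈ B, b < (t x : ℝ)} =
      {t : ι → unitInterval | ∀ x, t x ∈ if x ∈ H then {x : unitInterval | (x : ℝ) ≤ a} else
        if x ∈ B then {x : unitInterval | b < (x : ℝ)} else {x : unitInterval | a < (x : ℝ)}} := by
    ext t
    constructor
    · rintro ⟨h, h'⟩ x
      split_ifs with h1 h2
      · exact h.1 x h1
      · exact h' x h2
      · exact h.2 x (Finset.mem_compl.2 h1)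
    · intro h
      refine ⟨⟨fun x hx => by simpa [hx] using h x, fun x hx => ?_⟩, fun x hx => ?_⟩
      · have := h x
        rw [if_neg (Finset.mem_compl.1 hx)] at this
        split_ifs at this with h1
        · exact lt_of_le_of_lt hab this
        · exact this
      · simpa [hx, Finset.disjoint_right.1 hd hx] using h x
  rw [hbox, measureReal_box]
  have h : ∀ x, (volume : Measure unitInterval).real
      (if x ∈ H then {x : unitInterval | (x : ℝ) ≤ a} else
        if x ∈ B then {x : unitInterval | b < (x : ℝ)} else {x : unitInterval | a < (x : ℝ)}) =
      ((if x ∈ H then a else 1) * if x ∈ B then 1 - b else 1) *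
        if x ∈ Hᶜ \ B then 1 - a else 1 := by
    intro x
    by_cases h1 : x ∈ H
    · simp [h1, Finset.disjoint_left.1 hd h1, measureReal_unitInterval_le ha0 ha1]
    · by_cases h2 : x ∈ B
      · simp [h1, h2, measureReal_unitInterval_gt hb0 hb1]
      · simp [h1, h2, measureReal_unitInterval_gt ha0 ha1]
  simp_rw [h]
  rw [Finset.prod_mul_distrib, Finset.prod_mul_distrib, Finset.prod_ite_mem, Finset.prod_ite_mem,
    Finset.prod_ite_mem]
  simp only [Finset.univ_inter, Finset.prod_const]
  rw [← Finset.card_sdiff_add_card_eq_card hBH, pow_add]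
  ring

/-- The expected number of properties that hold is at most the maximal number of properties that
can hold. -/
theorem sum_measureReal_bornBy_le {κ : Type*} (s : Finset κ) (P : κ → Finset ι → Prop)
    [∀ α H, Decidable (P α H)] (a : ℝ) (N : ℕ)
    (hN : ∀ H, (s.filter fun α => P α H).card ≤ N) :
    ∑ α ∈ s, (volume : Measure (ι → unitInterval)).real {t | P α (bornBy t a)} ≤ N := by
  classical
  have h : ∀ Q : Finset ι → Prop, (volume : Measure (ι → unitInterval)).real {t | Q (bornBy t a)} =
      ∑ H, if Q H then (volume : Measure (ι → unitInterval)).real {t | bornBy t a = H} else 0 := by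
    intro Q
    have := measureReal_bornBy_inter Q a (MeasurableSet.univ : MeasurableSet (Set.univ : Set
      (ι → unitInterval)))
    simp only [Set.inter_univ] at this
    rw [this, Finset.sum_filter]
  calc ∑ α ∈ s, (volume : Measure (ι → unitInterval)).real {t | P α (bornBy t a)}
      = ∑ H, ∑ α ∈ s, if P α H then
          (volume : Measure (ι → unitInterval)).real {t | bornBy t a = H} else 0 := by
        rw [Finset.sum_comm]
        refine Finset.sum_congr rfl fun α _ => ?_
        rw [h (P α)]
        refine Finset.sum_congr rfl fun H _ => ?_
        congr
    _ ≤ ∑ H, N * (volume : Measure (ι → unitInterval)).real {t | bornBy t a = H} := by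
        refine Finset.sum_le_sum fun H _ => ?_
        rw [← Finset.sum_filter, Finset.sum_const, nsmul_eq_mul]
        exact mul_le_mul_of_nonneg_right (by exact_mod_cast hN H) measureReal_nonneg
    _ = N := by
        have := h (fun _ => True)
        simp only [if_true, Set.ofPred_true, probReal_univ] at this
        rw [← Finset.mul_sum, ← this, mul_one]

end Probability

end RandomComplex

namespace RandomComplex

/-! ### Counting cells and rivals -/

section Counting

/-- A potential `k`-simplex on `n` vertices. -/
abbrev Cell (k n : ℕ) : Type := {K : Finset (Fin n) // K.card = k + 1}

variable {k n : ℕ}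

/-- The cells containing `C` and avoiding `D`. -/
def cellsBetween (k : ℕ) (C D : Finset (Fin n)) : Finset (Cell k n) :=
  Finset.univ.filter fun K => C ⊆ K.1 ∧ Disjoint K.1 D

theorem mem_cellsBetween {C D : Finset (Fin n)} {K : Cell k n} :
    K ∈ cellsBetween k C D ↔ C ⊆ K.1 ∧ Disjoint K.1 D := by
  simp [cellsBetween]

theorem card_cellsBetween {C D : Finset (Fin n)} (hCD : Disjoint C D) (hC : C.card ≤ k + 1) :
    (cellsBetween k C D).card = (n - C.card - D.card).choose (k + 1 - C.card) := by
  have hcard : (Finset.univ \ (C ∪ D)).card = n - C.card - D.card := by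
    rw [Finset.card_sdiff_of_subset (Finset.subset_univ _), Finset.card_univ, Fintype.card_fin,
      Finset.card_union_of_disjoint hCD, Nat.sub_sub]
  rw [← hcard, ← Finset.card_powersetCard]
  symm
  have hdis : ∀ R ∈ (Finset.univ \ (C ∪ D)).powersetCard (k + 1 - C.card),
      Disjoint C R ∧ Disjoint R D := by
    intro R hR
    have h := (Finset.mem_powersetCard.1 hR).1
    constructor
    · exact Finset.disjoint_left.2 fun x hx hxR =>
        (Finset.mem_sdiff.1 (h hxR)).2 (Finset.mem_union_left _ hx)
    · exact Finset.disjoint_left.2 fun x hxR hx =>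
        (Finset.mem_sdiff.1 (h hxR)).2 (Finset.mem_union_right _ hx)
  refine Finset.card_bij (fun R hR => ⟨C ∪ R, by
    rw [Finset.card_union_of_disjoint (hdis R hR).1, (Finset.mem_powersetCard.1 hR).2]
    omega⟩) ?_ ?_ ?_
  · intro R hR
    rw [mem_cellsBetween]
    exact ⟨Finset.subset_union_left, Finset.disjoint_union_left.2 ⟨hCD, (hdis R hR).2⟩⟩
  · intro R hR R' hR' h
    have h' : C ∪ R = C ∪ R' := congrArg Subtype.val h
    have h1 := (hdis R hR).1
    have h2 := (hdis R' hR').1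
    rw [← Finset.union_sdiff_cancel_left h1, h', Finset.union_sdiff_cancel_left h2]
  · intro K hK
    obtain ⟨h1, h2⟩ := mem_cellsBetween.1 hK
    refine ⟨K.1 \ C, ?_, Subtype.ext (Finset.union_sdiff_of_subset h1)⟩
    rw [Finset.mem_powersetCard, Finset.card_sdiff_of_subset h1, K.2]
    refine ⟨fun x hx => ?_, rfl⟩
    rw [Finset.mem_sdiff] at hx
    rw [Finset.mem_sdiff, Finset.mem_union]
    exact ⟨Finset.mem_univ _, fun h => h.elim hx.2 (Finset.disjoint_left.1 h2 hx.1)⟩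

theorem card_cellsBetween_le {U : Finset (Fin n)} {r : ℕ} (hr : r ≤ U.card) (hrk : r ≤ k + 1)
    (D : Finset (Fin n)) : (cellsBetween k U D).card ≤ n ^ (k + 1 - r) := by
  obtain ⟨U', hU', hcard⟩ := Finset.exists_subset_card_eq hr
  have hsub : cellsBetween k U D ⊆ cellsBetween k U' ∅ := by
    intro K hK
    rw [mem_cellsBetween] at hK ⊢
    exact ⟨hU'.trans hK.1, Finset.disjoint_empty_right _⟩
  refine (Finset.card_le_card hsub).trans ?_
  rw [card_cellsBetween (Finset.disjoint_empty_right _) (hcard.trans_le hrk), hcard,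
    Finset.card_empty, Nat.sub_zero]
  exact (Nat.choose_le_choose _ (Nat.sub_le _ _)).trans (Nat.choose_le_pow _ _)

/-- The cells other than `K` that contain a petal of the flower in `K` with centre `C`. -/
def rivals (k : ℕ) (K C : Finset (Fin n)) : Finset (Cell k n) :=
  Finset.univ.filter fun K' => K'.1 ≠ K ∧ C ⊆ K'.1 ∧ ¬ Disjoint K'.1 (K \ C)

theorem mem_rivals {K C : Finset (Fin n)} {K' : Cell k n} :
    K' ∈ rivals k K C ↔ K'.1 ≠ K ∧ C ⊆ K'.1 ∧ ¬ Disjoint K'.1 (K \ C) := by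
  simp [rivals]

theorem mem_rivals_iff_petal {K C : Finset (Fin n)} {K' : Cell k n} :
    K' ∈ rivals k K C ↔ K'.1 ≠ K ∧ ∃ P ∈ flower K C, P ⊆ K'.1 := by
  rw [mem_rivals, Finset.not_disjoint_iff]
  simp only [mem_flower]
  constructor
  · rintro ⟨h1, h2, w, h3, h4⟩
    exact ⟨h1, _, ⟨w, h4, rfl⟩, Finset.union_subset h2 (Finset.singleton_subset_iff.2 h3)⟩
  · rintro ⟨h1, _, ⟨w, h4, rfl⟩, h5⟩
    rw [Finset.union_subset_iff, Finset.singleton_subset_iff] at h5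
    exact ⟨h1, h5.1, w, h5.2, h4⟩

/-- The number of rivals of a flower with a centre of size `i`. -/
def numRivals (k n i : ℕ) : ℕ := (n - i).choose (k + 1 - i) - (n - (k + 1)).choose (k + 1 - i) - 1

theorem card_rivals {K : Cell k n} {C : Finset (Fin n)} {i : ℕ} (hCK : C ⊆ K.1)
    (hC : C.card = i) (hi : i ≤ k) : (rivals k K.1 C).card = numRivals k n i := by
  have hne : (K.1 \ C).card = k + 1 - i := by rw [Finset.card_sdiff_of_subset hCK, K.2, hC]
  have hsub : cellsBetween k C (K.1 \ C) ⊆ cellsBetween k C ∅ := by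
    intro K' hK'
    rw [mem_cellsBetween] at hK' ⊢
    exact ⟨hK'.1, Finset.disjoint_empty_right _⟩
  -- The rivals are the cells containing `C`, without those that avoid `K \ C` and without `K`
  -- itself; this explains the two subtractions in `numRivals`.
  have heq : rivals k K.1 C = (cellsBetween k C ∅ \ cellsBetween k C (K.1 \ C)).erase K := by
    ext K'
    simp only [mem_rivals, Finset.mem_erase, Finset.mem_sdiff, mem_cellsBetween,
      Finset.disjoint_empty_right, and_true, not_and, ne_eq, Subtype.ext_iff]
    tauto
  have hmem : K ∈ cellsBetween k C ∅ \ cellsBetween k C (K.1 \ C) := by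
    simp only [Finset.mem_sdiff, mem_cellsBetween, Finset.disjoint_empty_right, and_true, not_and]
    refine ⟨hCK, fun _ h => ?_⟩
    have h0 := Finset.disjoint_of_subset_left (Finset.sdiff_subset (s := K.1) (t := C)) h
    rw [Finset.disjoint_self_iff_empty] at h0
    rw [h0, Finset.card_empty] at hne
    omega
  rw [heq, Finset.card_erase_of_mem hmem, Finset.card_sdiff_of_subset hsub,
    card_cellsBetween Finset.disjoint_sdiff (by omega),
    card_cellsBetween (Finset.disjoint_empty_right _) (by omega), hne, hC, numRivals,
    Finset.card_empty, Nat.sub_zero, show n - i - (k + 1 - i) = n - (k + 1) by omega]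

/-- As `K'` is not a rival of `K`, the two flowers share no petal. A common rival contains two
distinct sets of size `i + 1`, hence at least `i + 2` prescribed vertices, with at most `(k + 1)^2`
choices of the petals. -/
theorem card_rivals_inter_le {K K' : Cell k n} {C C' : Finset (Fin n)} {i : ℕ}
    (hCK' : C' ⊆ K'.1) (hC : C.card = i) (hC' : C'.card = i) (hi : i + 1 ≤ k) (hne : K ≠ K')
    (hK' : K' ∉ rivals k K.1 C) :
    (rivals k K.1 C ∩ rivals k K'.1 C').card ≤ (k + 1) ^ 2 * n ^ (k - 1 - i) := by
  have hsub : rivals k K.1 C ∩ rivals k K'.1 C' ⊆ ((K.1 \ C) ×ˢ (K'.1 \ C')).biUnion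
      fun w => cellsBetween k ((C ∪ {w.1}) ∪ (C' ∪ {w.2})) ∅ := by
    intro L hL
    simp only [Finset.mem_inter, mem_rivals, Finset.not_disjoint_iff] at hL
    obtain ⟨⟨-, h1, w, h2, h3⟩, -, h4, w', h5, h6⟩ := hL
    simp only [Finset.mem_biUnion, Finset.mem_product]
    refine ⟨(w, w'), ⟨h3, h6⟩, mem_cellsBetween.2 ⟨?_, Finset.disjoint_empty_right _⟩⟩
    exact Finset.union_subset (Finset.union_subset h1 (Finset.singleton_subset_iff.2 h2))
      (Finset.union_subset h4 (Finset.singleton_subset_iff.2 h5))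
  have hcard : ∀ w ∈ (K.1 \ C) ×ˢ (K'.1 \ C'),
      (cellsBetween k ((C ∪ {w.1}) ∪ (C' ∪ {w.2})) ∅).card ≤ n ^ (k - 1 - i) := by
    rintro ⟨w, w'⟩ hw
    simp only [Finset.mem_product, Finset.mem_sdiff] at hw
    have h1 : (C ∪ {w}).card = i + 1 := by
      rw [Finset.card_union_of_disjoint (Finset.disjoint_singleton_right.2 hw.1.2), hC]
      simp
    have h2 : (C' ∪ {w'}).card = i + 1 := by
      rw [Finset.card_union_of_disjoint (Finset.disjoint_singleton_right.2 hw.2.2), hC']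
      simp
    have h3 : i + 2 ≤ ((C ∪ {w}) ∪ (C' ∪ {w'})).card := by
      by_contra hlt
      have e1 : C ∪ {w} = (C ∪ {w}) ∪ (C' ∪ {w'}) :=
        Finset.eq_of_subset_of_card_le Finset.subset_union_left (by omega)
      have e2 : C' ∪ {w'} ⊆ C ∪ {w} := by
        rw [e1]
        exact Finset.subset_union_right
      have e3 : C' ∪ {w'} = C ∪ {w} := Finset.eq_of_subset_of_card_le e2 (by omega)
      refine hK' (mem_rivals_iff_petal.2 ⟨fun h => hne (Subtype.ext h.symm), C ∪ {w},
        mem_flower.2 ⟨w, Finset.mem_sdiff.2 hw.1, rfl⟩, ?_⟩)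
      rw [← e3]
      exact Finset.union_subset hCK' (Finset.singleton_subset_iff.2 hw.2.1)
    have h := card_cellsBetween_le (k := k) h3 (by omega) ∅
    rwa [show k + 1 - (i + 2) = k - 1 - i by omega] at h
  refine (Finset.card_le_card hsub).trans (Finset.card_biUnion_le.trans
    ((Finset.sum_le_sum hcard).trans ?_))
  rw [Finset.sum_const, smul_eq_mul, Finset.card_product, sq]
  refine Nat.mul_le_mul_right _ (Nat.mul_le_mul ?_ ?_)
  · exact (Finset.card_le_card Finset.sdiff_subset).trans K.2.le
  · exact (Finset.card_le_card Finset.sdiff_subset).trans K'.2.le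

theorem card_cell : Fintype.card (Cell k n) = n.choose (k + 1) := by
  have h := card_cellsBetween (k := k) (n := n) (Finset.disjoint_empty_right ∅) (by simp)
  simp only [Finset.card_empty, Nat.sub_zero] at h
  rw [← h, ← Finset.card_univ]
  congr 1
  ext K
  simp [mem_cellsBetween]

end Counting

/-! ### From sets of born cells to copies of the obstruction -/

section ComplexProcess

variable {k n : ℕ}

/-- The complex generated by a set of cells. -/
def complexOf (H : Finset (Cell k n)) : AbstractSimplicialComplex (Fin n) :=
  downwardClosure {B | ∃ h : B.card = k + 1, (⟨B, h⟩ : Cell k n) ∈ H}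

theorem randomComplex_eq (t : BirthTimes k n) (p : ℝ) :
    randomComplex t p = complexOf (bornBy t p) := by
  simp only [randomComplex, complexOf, mem_bornBy]

theorem subset_mem_complexOf {H : Finset (Cell k n)} {K : Cell k n} (hK : K ∈ H)
    {A : Finset (Fin n)} (hA : A.Nonempty) (hAK : A ⊆ K.1) : A ∈ (complexOf H).faces :=
  Or.inr ⟨hA, K.1, ⟨K.2, hK⟩, hAK⟩

theorem mem_complexOf {H : Finset (Cell k n)} {K : Cell k n} (hK : K ∈ H) :
    K.1 ∈ (complexOf H).faces :=
  subset_mem_complexOf hK (Finset.card_pos.1 (by rw [K.2]; omega)) subset_rfl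

theorem isSimplexOfDim_complexOf (hk : 1 ≤ k) {H : Finset (Cell k n)} {B : Finset (Fin n)} :
    IsSimplexOfDim (complexOf H) k B ↔ ∃ h : B.card = k + 1, (⟨B, h⟩ : Cell k n) ∈ H := by
  constructor
  · rintro ⟨⟨v, rfl⟩ | ⟨hne, B', ⟨h, hB'⟩, hsub⟩, hcard⟩
    · rw [Finset.card_singleton] at hcard
      omega
    · obtain rfl := Finset.eq_of_subset_of_card_le hsub (by rw [h, hcard])
      exact ⟨h, hB'⟩
  · rintro ⟨h, hB⟩
    exact ⟨mem_complexOf hB, h⟩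

theorem complexOf_mono {H H' : Finset (Cell k n)} (h : H ⊆ H') :
    (complexOf H).faces ⊆ (complexOf H').faces := by
  rintro A (hA | ⟨hne, B, ⟨hB, hBH⟩, hsub⟩)
  · exact Or.inl hA
  · exact Or.inr ⟨hne, B, ⟨hB, h hBH⟩, hsub⟩

theorem bornBy_mono (t : BirthTimes k n) {a b : ℝ} (hab : a ≤ b) : bornBy t a ⊆ bornBy t b :=
  fun _ hK => mem_bornBy.2 ((mem_bornBy.1 hK).trans hab)

/-- A cell born by time `a` whose rivals are born after time `b`, and which admits a crossing cycle
at time `a`, gives a copy of `M_i` throughout `[a, b]`. -/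
theorem containsM_of_survives (hk : 1 ≤ k) {i : ℕ} {t : BirthTimes k n} {a b p : ℝ} {K : Cell k n}
    {C : Finset (Fin n)} (hCK : C ⊆ K.1) (hC : C.card = i) (hK : (t K : ℝ) ≤ a)
    (hriv : ∀ K' ∈ rivals k K.1 C, b < (t K' : ℝ))
    (hJ : HasCrossingCycle (complexOf (bornBy t a)) i K.1 C) (hap : a ≤ p) (hpb : p ≤ b) :
    ContainsM k i (randomComplex t p) := by
  rw [randomComplex_eq]
  obtain ⟨J, hJ, hw⟩ := hJ.mono (complexOf_mono (bornBy_mono t hap))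
  refine ⟨K.1, C, J, ⟨mem_complexOf (mem_bornBy.2 (hK.trans hap)), K.2⟩, hCK, hC, ?_, hJ, hw⟩
  intro P hP K' hK' hPK'
  obtain ⟨h, hmem⟩ := (isSimplexOfDim_complexOf hk).1 hK'
  by_contra hne
  have h1 := hriv ⟨K', h⟩ (mem_rivals_iff_petal.2 ⟨hne, P, hP, hPK'⟩)
  exact absurd (mem_bornBy.1 hmem) (not_le.2 (hpb.trans_lt h1))

/-- Forgets the cycle of a copy. In the final phase only the birth order of the cell and its rivals
is read off, and a cycle is supplied afresh by a cone. -/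
theorem exists_cell_of_containsM (hk : 1 ≤ k) {i : ℕ} {t : BirthTimes k n} {p : ℝ}
    (h : ContainsM k i (randomComplex t p)) :
    ∃ (K : Cell k n) (C : Finset (Fin n)), C ⊆ K.1 ∧ C.card = i ∧ (t K : ℝ) ≤ p ∧
      ∀ K' ∈ rivals k K.1 C, p < (t K' : ℝ) := by
  rw [randomComplex_eq] at h
  obtain ⟨K, C, J, h⟩ := h
  obtain ⟨hcard, hK⟩ := (isSimplexOfDim_complexOf hk).1 h.simplex
  refine ⟨⟨K, hcard⟩, C, h.centre_subset, h.centre_card, mem_bornBy.1 hK, fun K' hK' => ?_⟩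
  obtain ⟨hne, P, hP, hPK'⟩ := mem_rivals_iff_petal.1 hK'
  by_contra hle
  exact hne (h.petal_unique P hP K'.1 ((isSimplexOfDim_complexOf hk).2
    ⟨K'.2, mem_bornBy.2 (not_lt.1 hle)⟩) hPK')

theorem isIsolatedVertex_of_forall {t : BirthTimes k n} {p : ℝ} {v : Fin n}
    (h : ∀ K : Cell k n, v ∈ K.1 → p < (t K : ℝ)) : IsIsolatedVertex (randomComplex t p) v := by
  rintro B (⟨w, rfl⟩ | ⟨-, B', ⟨hB', hle⟩, hsub⟩) hv
  · rw [Finset.mem_singleton.1 hv]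
  · exact absurd hle (not_le.2 (h ⟨B', hB'⟩ (hsub hv)))

/-- In every complex, few cells with private petals lack a crossing cycle. -/
theorem card_filter_not_hasCrossingCycle_le {i : ℕ} (hi : i ≤ k)
    (c : Finset (Fin n) → Finset (Fin n)) (hc : ∀ K : Cell k n, c K.1 ⊆ K.1 ∧ (c K.1).card = i)
    (H : Finset (Cell k n)) [DecidablePred fun K : Cell k n => K ∈ H ∧
      Disjoint H (rivals k K.1 (c K.1)) ∧ ¬ HasCrossingCycle (complexOf H) i K.1 (c K.1)] :
    (Finset.univ.filter fun K : Cell k n => K ∈ H ∧ Disjoint H (rivals k K.1 (c K.1)) ∧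
      ¬ HasCrossingCycle (complexOf H) i K.1 (c K.1)).card ≤ n.choose i := by
  rw [← Finset.card_map (Function.Embedding.subtype _)]
  have h := card_le_choose_of_not_hasCrossingCycle (G := complexOf H) (i := i) c
    ((Finset.univ.filter fun K : Cell k n => K ∈ H ∧ Disjoint H (rivals k K.1 (c K.1)) ∧
      ¬ HasCrossingCycle (complexOf H) i K.1 (c K.1)).map (Function.Embedding.subtype _))
  simp only [Fintype.card_fin] at h
  have hmem : ∀ K, K ∈ (Finset.univ.filter fun K : Cell k n => K ∈ H ∧
      Disjoint H (rivals k K.1 (c K.1)) ∧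
      ¬ HasCrossingCycle (complexOf H) i K.1 (c K.1)).map (Function.Embedding.subtype _) →
      ∃ hK : K.card = k + 1, (⟨K, hK⟩ : Cell k n) ∈ H ∧ Disjoint H (rivals k K (c K)) ∧
        ¬ HasCrossingCycle (complexOf H) i K (c K) := by
    intro K hK
    simp only [Finset.mem_map, Finset.mem_filter, Finset.mem_univ, true_and,
      Function.Embedding.coe_subtype] at hK
    obtain ⟨K, hK, rfl⟩ := hK
    exact ⟨K.2, hK⟩
  refine h ?_ ?_ ?_ ?_ ?_
  · intro K hK
    obtain ⟨hc, hH, -⟩ := hmem K hK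
    exact mem_complexOf hH
  · intro K hK
    obtain ⟨hcard, -⟩ := hmem K hK
    refine ⟨(hc ⟨K, hcard⟩).1, fun hsub => ?_⟩
    have := Finset.card_le_card hsub
    have := (hc ⟨K, hcard⟩).2
    simp only at this
    omega
  · intro K hK
    obtain ⟨hcard, -⟩ := hmem K hK
    exact (hc ⟨K, hcard⟩).2
  · intro K hK P hP K' hK' hPK'
    obtain ⟨hcard, -, hdis, -⟩ := hmem K hK
    obtain ⟨hcard', hH', -⟩ := hmem K' hK'
    by_contra hne
    exact Finset.disjoint_left.1 hdis hH'
      (mem_rivals_iff_petal.2 ⟨hne, P, hP, hPK'⟩)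
  · intro K hK
    exact (hmem K hK).choose_spec.2.2

end ComplexProcess

end RandomComplex

namespace RandomComplex

/-! ### Probability bounds for fixed `n` -/

section Bounds

theorem exp_neg_two_mul_le {b : ℝ} (hb0 : 0 ≤ b) (hb : b ≤ 1 / 2) :
    Real.exp (-(2 * b)) ≤ 1 - b := by
  rw [Real.exp_neg, inv_le_comm₀ (Real.exp_pos _) (by linarith)]
  have h1 := Real.add_one_le_exp (2 * b)
  refine le_trans ?_ h1
  rw [inv_eq_one_div, div_le_iff₀ (by linarith)]
  nlinarith

theorem one_sub_pow_le_exp {b : ℝ} (hb1 : b ≤ 1) (m : ℕ) : (1 - b) ^ m ≤ Real.exp (-(b * m)) := by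
  have h := pow_le_pow_left₀ (sub_nonneg.2 hb1) (Real.one_sub_le_exp_neg b) m
  rwa [← Real.exp_nat_mul, show (m : ℝ) * -b = -(b * m) by ring] at h

theorem lowHigh_inter {ι : Type*} [DecidableEq ι] (A A' B B' : Finset ι) (a b : ℝ) :
    lowHigh A B a b ∩ lowHigh A' B' a b = lowHigh (A ∪ A') (B ∪ B') a b := by
  ext t
  simp only [lowHigh, Set.mem_inter_iff, Set.mem_ofPred_eq, Finset.mem_union]
  constructor
  · rintro ⟨⟨h1, h2⟩, h3, h4⟩
    exact ⟨fun x hx => hx.elim (h1 x) (h3 x), fun x hx => hx.elim (h2 x) (h4 x)⟩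
  · rintro ⟨h1, h2⟩
    exact ⟨⟨fun x hx => h1 x (Or.inl hx), fun x hx => h2 x (Or.inl hx)⟩,
      fun x hx => h1 x (Or.inr hx), fun x hx => h2 x (Or.inr hx)⟩

/-- If a coordinate has to be both low and high, the intersection is empty. Otherwise the only gain
over independence is that the common high coordinates are counted once, a factor `(1 - b)^(-|B ∩
B'|)`, which is at most `exp (2 b I)`. -/
theorem measureReal_lowHigh_inter_le {ι : Type*} [Fintype ι] [DecidableEq ι] {A A' B B' : Finset ι}
    (hAB : Disjoint A B) (hAB' : Disjoint A' B') (hAA' : Disjoint A A') {a b : ℝ} (ha0 : 0 ≤ a)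
    (hab : a ≤ b) (hb : b ≤ 1 / 2) {I : ℝ}
    (hI : Disjoint (A ∪ A') (B ∪ B') → ((B ∩ B').card : ℝ) ≤ I) :
    (volume : Measure (ι → unitInterval)).real (lowHigh A B a b ∩ lowHigh A' B' a b) ≤
      (1 + (Real.exp (2 * b * I) - 1)) *
        ((volume : Measure (ι → unitInterval)).real (lowHigh A B a b) *
          (volume : Measure (ι → unitInterval)).real (lowHigh A' B' a b)) := by
  have hb0 := ha0.trans hab
  rw [add_sub_cancel]
  by_cases hd : Disjoint (A ∪ A') (B ∪ B')
  · rw [lowHigh_inter, measureReal_lowHigh hd ha0 (by linarith) hb0 (by linarith),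
      measureReal_lowHigh hAB ha0 (by linarith) hb0 (by linarith),
      measureReal_lowHigh hAB' ha0 (by linarith) hb0 (by linarith),
      Finset.card_union_of_disjoint hAA', pow_add]
    have h1 : (1 - b) ^ (B ∪ B').card ≤
        Real.exp (2 * b * I) * ((1 - b) ^ B.card * (1 - b) ^ B'.card) := by
      rw [← pow_add, ← Finset.card_union_add_card_inter, pow_add]
      have h2 : 1 ≤ Real.exp (2 * b * I) * (1 - b) ^ (B ∩ B').card := by
        calc (1 : ℝ) = Real.exp (2 * b * (B ∩ B').card) *
              Real.exp (-(2 * b)) ^ (B ∩ B').card := by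
              rw [← Real.exp_nat_mul, ← Real.exp_add]
              simp [mul_comm]
          _ ≤ _ := by
              refine mul_le_mul (Real.exp_le_exp.2 (mul_le_mul_of_nonneg_left (hI hd)
                (by linarith))) (pow_le_pow_left₀ (Real.exp_pos _).le
                (exp_neg_two_mul_le hb0 hb) _) (by positivity) (Real.exp_pos _).le
      have h3 : 0 ≤ (1 - b) ^ (B ∪ B').card := pow_nonneg (by linarith) _
      nlinarith
    have h4 : 0 ≤ a ^ A.card * a ^ A'.card := by positivity
    nlinarith [mul_le_mul_of_nonneg_left h1 h4]
  · obtain ⟨x, hx, hx'⟩ := Finset.not_disjoint_iff.1 hd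
    have : lowHigh A B a b ∩ lowHigh A' B' a b = ∅ := by
      rw [lowHigh_inter, Set.eq_empty_iff_forall_notMem]
      rintro t ⟨h1, h2⟩
      linarith [h1 x hx, h2 x hx']
    rw [this, measureReal_empty]
    have := measureReal_nonneg (μ := (volume : Measure (ι → unitInterval))) (s := lowHigh A B a b)
    have := measureReal_nonneg (μ := (volume : Measure (ι → unitInterval)))
      (s := lowHigh A' B' a b)
    positivity

variable {k n : ℕ}

/-- With high probability some cell is born by time `a`, has its rivals born after time `b`, and
admits a crossing cycle at time `a`. -/
theorem measureReal_no_survivor_le {i : ℕ} (hi : i + 1 ≤ k) (hn : k + 1 ≤ n)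
    (c : Finset (Fin n) → Finset (Fin n)) (hc : ∀ K : Cell k n, c K.1 ⊆ K.1 ∧ (c K.1).card = i)
    {a b : ℝ} (ha0 : 0 < a) (hab : a ≤ b) (hb : b ≤ 1 / 2) {μ : ℝ}
    (hμ : μ = n.choose (k + 1) * (a * (1 - b) ^ numRivals k n i)) :
    (volume : Measure (BirthTimes k n)).real {t | ∀ K : Cell k n,
      ((t K : ℝ) ≤ a ∧ ∀ K' ∈ rivals k K.1 (c K.1), b < (t K' : ℝ)) →
        ¬ HasCrossingCycle (complexOf (bornBy t a)) i K.1 (c K.1)} ≤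
      4 / μ + 4 * (Real.exp (2 * b * ((k + 1) ^ 2 * n ^ (k - 1 - i) : ℕ)) - 1) +
        2 * (n.choose i * ((1 - b) ^ numRivals k n i / (1 - a) ^ numRivals k n i)) / μ := by
  classical
  set L := numRivals k n i with hL_def
  have hL : ∀ K : Cell k n, (rivals k K.1 (c K.1)).card = L := fun K =>
    card_rivals (hc K).1 (hc K).2 (by omega)
  have hdis : ∀ K : Cell k n, Disjoint {K} (rivals k K.1 (c K.1)) := fun K => by
    rw [Finset.disjoint_singleton_left, mem_rivals]
    exact fun h => h.1 rfl
  set P : Cell k n → Finset (Cell k n) → Prop := fun K H =>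
    K ∈ H ∧ Disjoint H (rivals k K.1 (c K.1)) ∧ ¬ HasCrossingCycle (complexOf H) i K.1 (c K.1)
    with hP_def
  have hvol : ∀ K : Cell k n, (volume : Measure (BirthTimes k n)).real
      (lowHigh {K} (rivals k K.1 (c K.1)) a b) = a * (1 - b) ^ L := fun K => by
    rw [measureReal_lowHigh (hdis K) ha0.le (by linarith) (by linarith) (by linarith), hL]
    simp
  have hY : ∀ K : Cell k n, (volume : Measure (BirthTimes k n)).real
      ({t | P K (bornBy t a)} ∩ {t | ∀ x ∈ rivals k K.1 (c K.1), b < (t x : ℝ)}) =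
        (volume : Measure (BirthTimes k n)).real {t | P K (bornBy t a)} *
          ((1 - b) ^ L / (1 - a) ^ L) := fun K => by
    have h := measureReal_bornBy_survive (P K) (rivals k K.1 (c K.1)) (fun H hH => hH.2.1) ha0.le
      hab (by linarith)
    rw [hL] at h
    rw [← mul_div_assoc, ← h, mul_div_cancel_right₀]
    exact pow_ne_zero _ (by linarith)
  have hmain := measureReal_forall_imp_le (volume : Measure (BirthTimes k n)) Finset.univ
    (fun K : Cell k n => lowHigh {K} (rivals k K.1 (c K.1)) a b)
    (fun K => {t | P K (bornBy t a)} ∩ {t | ∀ x ∈ rivals k K.1 (c K.1), b < (t x : ℝ)})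
    (η := Real.exp (2 * b * ((k + 1) ^ 2 * n ^ (k - 1 - i) : ℕ)) - 1) (μ := μ)
    (y := n.choose i * ((1 - b) ^ L / (1 - a) ^ L))
    (fun K _ => measurableSet_lowHigh _ _ _ _)
    (fun K _ => (measurableSet_bornBy (P K) a).inter (by
      simpa [lowHigh] using measurableSet_lowHigh (∅ : Finset (Cell k n))
        (rivals k K.1 (c K.1)) a b)) ?_ ?_ ?_ ?_ ?_
  -- When no survivor has a crossing cycle, every survivor is bad. Its rivals are unborn at time `a`
  -- since they are born after `b ≥ a`.
  · refine (measureReal_mono ?_).trans hmain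
    intro t ht K _ hK
    have h1 : (t K : ℝ) ≤ a := hK.1 K (Finset.mem_singleton_self K)
    refine ⟨⟨mem_bornBy.2 h1, ?_, ht K ⟨h1, hK.2⟩⟩, hK.2⟩
    refine Finset.disjoint_right.2 fun K' hK' h => ?_
    linarith [mem_bornBy.1 h, hK.2 K' hK']
  · rw [sub_nonneg]
    refine Real.one_le_exp (mul_nonneg (by linarith) (Nat.cast_nonneg _))
  · rw [hμ]
    have := Nat.choose_pos hn
    have : (0 : ℝ) < 1 - b := by linarith
    positivity
  · simp only [hvol]
    rw [Finset.sum_const, Finset.card_univ, card_cell, nsmul_eq_mul, hμ]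
  · simp only [hY]
    rw [← Finset.sum_mul]
    refine mul_le_mul_of_nonneg_right ?_ (div_nonneg (pow_nonneg (by linarith) _)
      (pow_nonneg (by linarith) _))
    exact sum_measureReal_bornBy_le Finset.univ P a (n.choose i) fun H =>
      card_filter_not_hasCrossingCycle_le (by omega) c hc H
  · intro K _ K' _ hne
    refine measureReal_lowHigh_inter_le (hdis K) (hdis K') (by simpa using hne) ha0.le hab hb ?_
    intro hd
    refine Nat.cast_le.2 (card_rivals_inter_le (hc K').1 (hc K).2 (hc K').2 hi hne fun h => ?_)
    exact Finset.disjoint_left.1 hd (show K' ∈ {K} ∪ {K'} by simp)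
      (Finset.mem_union_left _ h)

/-- With high probability some vertex is in no cell born by time `b`. -/
theorem measureReal_no_isolated_le (hk : 1 ≤ k) (hn : 1 ≤ n) {b : ℝ} (hb0 : 0 ≤ b)
    (hb : b ≤ 1 / 2) {μ : ℝ} (hμ : μ = n * (1 - b) ^ (n - 1).choose k) :
    (volume : Measure (BirthTimes k n)).real
      {t | ∀ v : Fin n, ¬ ∀ K : Cell k n, v ∈ K.1 → b < (t K : ℝ)} ≤
      4 / μ + 4 * (Real.exp (2 * b * (n ^ (k - 1) : ℕ)) - 1) := by
  classical
  have hcard : ∀ v : Fin n, (cellsBetween k {v} ∅).card = (n - 1).choose k := fun v => by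
    rw [card_cellsBetween (Finset.disjoint_empty_right _) (by simp)]
    simp
  -- With empty events `Y`, the bound reduces to Chebyshev: the probability that no event `X`
  -- occurs.
  have hmain := measureReal_forall_imp_le (volume : Measure (BirthTimes k n)) Finset.univ
    (fun v : Fin n => lowHigh ∅ (cellsBetween k {v} ∅) b b) (fun v => ∅)
    (η := Real.exp (2 * b * (n ^ (k - 1) : ℕ)) - 1) (μ := μ) (y := 0)
    (fun v _ => measurableSet_lowHigh _ _ _ _) (fun v _ => MeasurableSet.empty) ?_ ?_ ?_ ?_ ?_
  · rw [mul_zero, zero_div, add_zero] at hmain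
    refine (measureReal_mono ?_).trans hmain
    intro t ht v _ hv
    refine ht v fun K hK => hv.2 K (mem_cellsBetween.2 ⟨?_, Finset.disjoint_empty_right _⟩)
    simpa using hK
  · rw [sub_nonneg]
    exact Real.one_le_exp (mul_nonneg (by linarith) (Nat.cast_nonneg _))
  · rw [hμ]
    have : (0 : ℝ) < 1 - b := by linarith
    positivity
  · simp_rw [measureReal_lowHigh (Finset.disjoint_empty_left _) hb0 (show b ≤ 1 by linarith) hb0
      (show b ≤ 1 by linarith), hcard]
    simp [hμ]
  · simp
  · intro v _ w _ hne
    refine measureReal_lowHigh_inter_le (Finset.disjoint_empty_left _) (Finset.disjoint_empty_left _)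
      (Finset.disjoint_empty_left _) hb0 le_rfl hb fun _ => Nat.cast_le.2 ?_
    have hsub : cellsBetween k {v} ∅ ∩ cellsBetween k {w} ∅ ⊆ cellsBetween k {v, w} ∅ := by
      intro K hK
      simp only [Finset.mem_inter, mem_cellsBetween, Finset.singleton_subset_iff] at hK
      rw [mem_cellsBetween, Finset.insert_subset_iff, Finset.singleton_subset_iff]
      exact ⟨⟨hK.1.1, hK.2.1⟩, hK.1.2⟩
    refine (Finset.card_le_card hsub).trans ((card_cellsBetween_le (r := 2)
      (Finset.card_pair hne).ge (by omega) ∅).trans (le_of_eq ?_))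
    rw [show k + 1 - 2 = k - 1 by omega]

theorem measureReal_unitInterval_gt_le_exp {u : ℝ} (hu : 0 ≤ u) :
    (volume : Measure unitInterval).real {x | u < (x : ℝ)} ≤ Real.exp (-u) := by
  by_cases h1 : u ≤ 1
  · rw [measureReal_unitInterval_gt hu h1]
    exact Real.one_sub_le_exp_neg u
  · have : {x : unitInterval | u < (x : ℝ)} = ∅ := by
      rw [Set.eq_empty_iff_forall_notMem]
      intro x hx
      exact h1 (le_of_lt (lt_of_lt_of_le hx x.2.2))
    rw [this, measureReal_empty]
    exact (Real.exp_pos _).le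

/-- Heuristically this is the integral of `exp (-s L)` over `s > T`. It is discretised by cutting
the time after `T` into slabs of length `1 / L`: each has probability at most `1 / L` for `x₀`, and
the requirement on `B` contributes at most `exp (-T L - l)` in slab `l`. -/
theorem measureReal_first_born_le {ι : Type*} [Fintype ι] [DecidableEq ι] {x₀ : ι} {B : Finset ι}
    (hx₀ : x₀ ∉ B) (hB : 0 < B.card) {T : ℝ} (hT : 0 ≤ T) :
    (volume : Measure (ι → unitInterval)).real
      {t | T < (t x₀ : ℝ) ∧ ∀ x ∈ B, (t x₀ : ℝ) < (t x : ℝ)} ≤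
      2 / B.card * Real.exp (-(T * B.card)) := by
  set L := B.card with hL
  have hL0 : (0 : ℝ) < L := by exact_mod_cast hB
  let E : ℕ → Set (ι → unitInterval) := fun l => {t | ∀ x, t x ∈
    if x = x₀ then {y : unitInterval | T + l / L < (y : ℝ) ∧ (y : ℝ) ≤ T + (l + 1) / L} else
      if x ∈ B then {y : unitInterval | T + l / L < (y : ℝ)} else Set.univ}
  have hcover : {t : ι → unitInterval | T < (t x₀ : ℝ) ∧ ∀ x ∈ B, (t x₀ : ℝ) < (t x : ℝ)} ⊆
      ⋃ l ∈ Finset.range (L + 1), E l := by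
    rintro t ⟨h1, h2⟩
    have hpos : 0 < ((t x₀ : ℝ) - T) * L := mul_pos (sub_pos.2 h1) hL0
    obtain ⟨l, hl⟩ : ∃ l, ⌈((t x₀ : ℝ) - T) * L⌉₊ = l + 1 :=
      Nat.exists_eq_succ_of_ne_zero (Nat.ceil_pos.2 hpos).ne'
    have hu := Nat.le_ceil (((t x₀ : ℝ) - T) * L)
    have hlow := Nat.ceil_lt_add_one hpos.le
    rw [hl] at hu hlow
    push_cast at hu hlow
    have ht1 := (t x₀).2.2
    have hlL : (l : ℝ) < L := by nlinarith
    have hlow' : T + l / L < (t x₀ : ℝ) := by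
      rw [← lt_sub_iff_add_lt', div_lt_iff₀ hL0]
      linarith
    have hup' : (t x₀ : ℝ) ≤ T + (l + 1) / L := by
      rw [← sub_le_iff_le_add', le_div_iff₀ hL0]
      exact hu
    simp only [Set.mem_iUnion, Finset.mem_range]
    refine ⟨l, ?_, fun x => ?_⟩
    · have : l < L := by exact_mod_cast hlL
      omega
    · split_ifs with hx hxB
      · rw [hx]
        exact ⟨hlow', hup'⟩
      · exact hlow'.trans (h2 x hxB)
      · trivial
  have hE : ∀ l : ℕ, (volume : Measure (ι → unitInterval)).real (E l) ≤
      1 / L * (Real.exp (-(T * L)) * (1 / 2) ^ l) := by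
    intro l
    rw [measureReal_box]
    have h : ∀ x, (volume : Measure unitInterval).real
        (if x = x₀ then {y : unitInterval | T + l / L < (y : ℝ) ∧ (y : ℝ) ≤ T + (l + 1) / L} else
          if x ∈ B then {y : unitInterval | T + l / L < (y : ℝ)} else Set.univ) ≤
        (if x ∈ ({x₀} : Finset ι) then 1 / (L : ℝ) else 1) *
          if x ∈ B then Real.exp (-(T + l / L)) else 1 := by
      intro x
      by_cases hx : x = x₀
      · subst hx
        simp only [if_true, Finset.mem_singleton, hx₀, if_false, mul_one]
        refine (measureReal_unitInterval_Ioc_le (by gcongr; linarith)).trans (le_of_eq ?_)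
        field_simp
        ring
      · by_cases hxB : x ∈ B
        · simp only [hx, hxB, if_true, if_false, Finset.mem_singleton, one_mul]
          exact measureReal_unitInterval_gt_le_exp (by positivity)
        · simp [hx, hxB]
    refine (Finset.prod_le_prod (fun x _ => measureReal_nonneg) fun x _ => h x).trans ?_
    rw [Finset.prod_mul_distrib, Finset.prod_ite_mem, Finset.prod_ite_mem]
    simp only [Finset.univ_inter, Finset.prod_const, Finset.card_singleton, pow_one, ← hL]
    refine mul_le_mul_of_nonneg_left ?_ (by positivity)
    rw [← Real.exp_nat_mul, show (L : ℝ) * -(T + l / L) = -(T * L) + l * (-1) by field_simp; ring,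
      Real.exp_add, Real.exp_nat_mul]
    refine mul_le_mul_of_nonneg_left (pow_le_pow_left₀ (Real.exp_pos _).le ?_ _)
      (Real.exp_pos _).le
    -- The ratio `exp (-1)` is replaced by `1 / 2`, so that the geometric series sums to at most
    -- `2`.
    rw [Real.exp_neg, one_div]
    refine inv_anti₀ (by norm_num) ?_
    linarith [Real.add_one_le_exp (1 : ℝ)]
  refine (measureReal_mono hcover (measure_ne_top _ _)).trans
    ((measureReal_biUnion_finset_le _ _).trans
    ((Finset.sum_le_sum fun l _ => hE l).trans ?_))
  rw [← Finset.mul_sum, ← Finset.mul_sum]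
  have hgeo : ∑ l ∈ Finset.range (L + 1), ((1 : ℝ) / 2) ^ l ≤ 2 := sum_geometric_two_le _
  calc 1 / (L : ℝ) * (Real.exp (-(T * L)) * ∑ l ∈ Finset.range (L + 1), ((1 : ℝ) / 2) ^ l)
      ≤ 1 / (L : ℝ) * (Real.exp (-(T * L)) * 2) := by gcongr
    _ = 2 / L * Real.exp (-(T * L)) := by ring

theorem card_powersetCard_le_two_pow (K : Cell k n) (r : ℕ) :
    (K.1.powersetCard r).card ≤ 2 ^ (k + 1) := by
  have h := Finset.card_le_card (show K.1.powersetCard r ⊆ K.1.powerset from fun C hC =>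
    Finset.mem_powerset.2 (Finset.mem_powersetCard.1 hC).1)
  rwa [Finset.card_powerset, K.2] at h

/-- With high probability no cell is born late and before all the rivals of one of its flowers. -/
theorem measureReal_late_le {i : ℕ} (hi : i ≤ k) (hL : 0 < numRivals k n i) {T : ℝ} (hT : 0 ≤ T) :
    (volume : Measure (BirthTimes k n)).real {t | ∃ (K : Cell k n) (C : Finset (Fin n)),
      C ⊆ K.1 ∧ C.card = i ∧ T < (t K : ℝ) ∧ ∀ K' ∈ rivals k K.1 C, (t K : ℝ) < (t K' : ℝ)} ≤
      n.choose (k + 1) * (2 ^ (k + 1) *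
        (2 / numRivals k n i * Real.exp (-(T * numRivals k n i)))) := by
  classical
  have hcover : {t : BirthTimes k n | ∃ (K : Cell k n) (C : Finset (Fin n)),
      C ⊆ K.1 ∧ C.card = i ∧ T < (t K : ℝ) ∧ ∀ K' ∈ rivals k K.1 C, (t K : ℝ) < (t K' : ℝ)} ⊆
      ⋃ K ∈ (Finset.univ : Finset (Cell k n)), ⋃ C ∈ K.1.powersetCard i,
        {t | T < (t K : ℝ) ∧ ∀ K' ∈ rivals k K.1 C, (t K : ℝ) < (t K' : ℝ)} := by
    rintro t ⟨K, C, h1, h2, h3⟩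
    simp only [Set.mem_iUnion, Finset.mem_powersetCard]
    exact ⟨K, Finset.mem_univ _, C, ⟨h1, h2⟩, h3⟩
  refine (measureReal_mono hcover (measure_ne_top _ _)).trans
    ((measureReal_biUnion_finset_le _ _).trans ?_)
  refine (Finset.sum_le_card_nsmul _ _ _ fun K _ => ?_).trans_eq (by
    rw [Finset.card_univ, card_cell, nsmul_eq_mul])
  refine (measureReal_biUnion_finset_le _ _).trans ?_
  refine (Finset.sum_le_card_nsmul _ _ (2 / numRivals k n i *
    Real.exp (-(T * numRivals k n i))) fun C hC => ?_).trans ?_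
  · obtain ⟨h1, h2⟩ := Finset.mem_powersetCard.1 hC
    have h3 := card_rivals h1 h2 hi
    have := measureReal_first_born_le (x₀ := K) (B := rivals k K.1 C)
      (fun h => (mem_rivals.1 h).1 rfl) (h3 ▸ hL) hT
    rwa [h3] at this
  · rw [nsmul_eq_mul]
    refine mul_le_mul_of_nonneg_right ?_ (by positivity)
    exact_mod_cast card_powersetCard_le_two_pow K i

/-- Union bound over the choice, for each apex `a ∈ A`, of a subset `U` whose join with `a` is
uncovered. Only cells avoiding the other apexes are inspected, which makes the families for
different `a` disjoint and the failures independent for a fixed choice. -/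
theorem measureReal_cone_fails_le {i m : ℕ} (hi : i ≤ k) {S A : Finset (Fin n)}
    (hS : S.card = i + 1) (hA : A.card = m) (hSA : Disjoint S A) {p : ℝ} (hp0 : 0 ≤ p)
    (hp1 : p ≤ 1) :
    (volume : Measure (BirthTimes k n)).real {t | ∀ a ∈ A, ∃ U ∈ S.powersetCard i,
      ∀ K ∈ cellsBetween k (insert a U) (A.erase a), p < (t K : ℝ)} ≤
      (i + 1) ^ m * Real.exp (-(p * (m * (n - i - m).choose (k - i) : ℕ))) := by
  classical
  have hcover : {t : BirthTimes k n | ∀ a ∈ A, ∃ U ∈ S.powersetCard i,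
      ∀ K ∈ cellsBetween k (insert a U) (A.erase a), p < (t K : ℝ)} ⊆
      ⋃ f ∈ Fintype.piFinset fun _ : A => S.powersetCard i,
        lowHigh ∅ (Finset.univ.biUnion fun a : A =>
          cellsBetween k (insert a.1 (f a)) (A.erase a.1)) p p := by
    intro t ht
    choose f hf hf' using fun a : A => ht a.1 a.2
    simp only [Set.mem_iUnion, Fintype.mem_piFinset]
    refine ⟨f, hf, by simp, fun K hK => ?_⟩
    obtain ⟨a, -, ha⟩ := Finset.mem_biUnion.1 hK
    exact hf' a K ha
  refine (measureReal_mono hcover (measure_ne_top _ _)).trans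
    ((measureReal_biUnion_finset_le _ _).trans ?_)
  refine (Finset.sum_le_card_nsmul _ _ (Real.exp (-(p * (m * (n - i - m).choose (k - i) : ℕ))))
    fun f hf => ?_).trans (le_of_eq ?_)
  · rw [measureReal_lowHigh (Finset.disjoint_empty_left _) hp0 hp1 hp0 hp1]
    rw [Fintype.mem_piFinset] at hf
    have hcard : (Finset.univ.biUnion fun a : A =>
        cellsBetween k (insert a.1 (f a)) (A.erase a.1)).card =
        m * (n - i - m).choose (k - i) := by
      rw [Finset.card_biUnion]
      · rw [Finset.sum_const_nat (m := (n - i - m).choose (k - i))]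
        · rw [Finset.card_univ, Fintype.card_coe, hA]
        · intro a _
          obtain ⟨h1, h2⟩ := Finset.mem_powersetCard.1 (hf a)
          have ha : a.1 ∉ f a := fun h => Finset.disjoint_left.1 hSA (h1 h) a.2
          have h3 : (insert a.1 (f a)).card = i + 1 := by
            rw [Finset.card_insert_of_notMem ha, h2]
          have hm : 0 < m := hA ▸ Finset.card_pos.2 ⟨a.1, a.2⟩
          rw [card_cellsBetween, h3, Finset.card_erase_of_mem a.2, hA]
          · congr 1 <;> omega
          · rw [Finset.disjoint_insert_left]
            exact ⟨Finset.notMem_erase _ _, Finset.disjoint_of_subset_left h1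
              (Finset.disjoint_of_subset_right (Finset.erase_subset _ _) hSA)⟩
          · omega
      · intro a _ a' _ hne
        refine Finset.disjoint_left.2 fun K hK hK' => ?_
        rw [mem_cellsBetween] at hK hK'
        exact Finset.disjoint_left.1 hK.2 (hK'.1 (Finset.mem_insert_self _ _))
          (Finset.mem_erase.2 ⟨fun h => hne (Subtype.ext h.symm), a'.2⟩)
    rw [hcard, Finset.card_empty, pow_zero, one_mul]
    exact one_sub_pow_le_exp hp1 _
  · rw [nsmul_eq_mul, Fintype.card_piFinset, Finset.prod_const, Finset.card_powersetCard, hS,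
      Finset.card_univ, Fintype.card_coe, hA, Nat.choose_succ_self_right]
    push_cast
    rfl

/-- With high probability every `(i+1)`-subset of every cell `K` is the base of a cone, with apex
outside `K`, all of whose other faces are covered by cells born by time `p`. -/
theorem measureReal_no_cone_le {i m : ℕ} (hi : i ≤ k) (hn : k + 1 + m ≤ n) {p : ℝ} (hp0 : 0 ≤ p)
    (hp1 : p ≤ 1) :
    (volume : Measure (BirthTimes k n)).real {t | ∃ (K : Cell k n) (S : Finset (Fin n)),
      S ⊆ K.1 ∧ S.card = i + 1 ∧ ∀ a ∉ K.1, ∃ U ⊆ S, U.card = i ∧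
        ∀ K' : Cell k n, insert a U ⊆ K'.1 → p < (t K' : ℝ)} ≤
      n.choose (k + 1) * (2 ^ (k + 1) *
        ((i + 1) ^ m * Real.exp (-(p * (m * (n - i - m).choose (k - i) : ℕ))))) := by
  classical
  have hA : ∀ K : Cell k n, ∃ A ⊆ Finset.univ \ K.1, A.card = m := fun K => by
    refine Finset.exists_subset_card_eq ?_
    rw [Finset.card_sdiff_of_subset (Finset.subset_univ _), Finset.card_univ, Fintype.card_fin, K.2]
    omega
  choose A hAK hAm using hA
  have hcover : {t : BirthTimes k n | ∃ (K : Cell k n) (S : Finset (Fin n)),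
      S ⊆ K.1 ∧ S.card = i + 1 ∧ ∀ a ∉ K.1, ∃ U ⊆ S, U.card = i ∧
        ∀ K' : Cell k n, insert a U ⊆ K'.1 → p < (t K' : ℝ)} ⊆
      ⋃ K ∈ (Finset.univ : Finset (Cell k n)), ⋃ S ∈ K.1.powersetCard (i + 1),
        {t | ∀ a ∈ A K, ∃ U ∈ S.powersetCard i,
          ∀ K' ∈ cellsBetween k (insert a U) ((A K).erase a), p < (t K' : ℝ)} := by
    rintro t ⟨K, S, h1, h2, h3⟩
    simp only [Set.mem_iUnion, Finset.mem_powersetCard]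
    refine ⟨K, Finset.mem_univ _, S, ⟨h1, h2⟩, fun a ha => ?_⟩
    obtain ⟨U, hU, hUi, hU'⟩ := h3 a (Finset.mem_sdiff.1 (hAK K ha)).2
    exact ⟨U, ⟨hU, hUi⟩, fun K' hK' => hU' K' (mem_cellsBetween.1 hK').1⟩
  refine (measureReal_mono hcover (measure_ne_top _ _)).trans
    ((measureReal_biUnion_finset_le _ _).trans ?_)
  refine (Finset.sum_le_card_nsmul _ _ _ fun K _ => ?_).trans_eq (by
    rw [Finset.card_univ, card_cell, nsmul_eq_mul])
  refine (measureReal_biUnion_finset_le _ _).trans ?_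
  refine (Finset.sum_le_card_nsmul _ _ ((i + 1) ^ m *
    Real.exp (-(p * (m * (n - i - m).choose (k - i) : ℕ)))) fun S hS => ?_).trans ?_
  · obtain ⟨h1, h2⟩ := Finset.mem_powersetCard.1 hS
    refine measureReal_cone_fails_le hi h2 (hAm K) ?_ hp0 hp1
    exact Finset.disjoint_left.2 fun x hx hxA => (Finset.mem_sdiff.1 (hAK K hxA)).2 (h1 hx)
  · rw [nsmul_eq_mul]
    refine mul_le_mul_of_nonneg_right ?_ (by positivity)
    exact_mod_cast card_powersetCard_le_two_pow K (i + 1)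

end Bounds

end RandomComplex

namespace RandomComplex

/-! ### Asymptotic estimates and long-lived survivors -/

section Asymptotics

theorem withHighProbability_iff {k : ℕ} {A : ∀ n : ℕ, Set (BirthTimes k n)} :
    WithHighProbability k A ↔
      Tendsto (fun n => (volume : Measure (BirthTimes k n)).real (A n)ᶜ) atTop (𝓝 0) := by
  rw [WithHighProbability, ← ENNReal.tendsto_toReal_iff (fun _ => measure_ne_top _ _)
    ENNReal.zero_ne_top]
  rfl

theorem WithHighProbability.of_le {k : ℕ} {A : ∀ n : ℕ, Set (BirthTimes k n)} {ε : ℕ → ℝ}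
    (hε : Tendsto ε atTop (𝓝 0))
    (h : ∀ᶠ n in atTop, (volume : Measure (BirthTimes k n)).real (A n)ᶜ ≤ ε n) :
    WithHighProbability k A :=
  withHighProbability_iff.2 (squeeze_zero' (Eventually.of_forall fun _ => measureReal_nonneg) h hε)

theorem WithHighProbability.mono {k : ℕ} {A B : ∀ n : ℕ, Set (BirthTimes k n)}
    (hA : WithHighProbability k A) (h : ∀ᶠ n in atTop, A n ⊆ B n) : WithHighProbability k B :=
  .of_le (withHighProbability_iff.1 hA)
    (h.mono fun _ hn => measureReal_mono (Set.compl_subset_compl.2 hn))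

theorem WithHighProbability.inter {k : ℕ} {A B : ∀ n : ℕ, Set (BirthTimes k n)}
    (hA : WithHighProbability k A) (hB : WithHighProbability k B) :
    WithHighProbability k fun n => A n ∩ B n := by
  have h := (withHighProbability_iff.1 hA).add (withHighProbability_iff.1 hB)
  rw [add_zero] at h
  refine .of_le h (Eventually.of_forall fun n => ?_)
  rw [Set.compl_inter]
  exact measureReal_union_le _ _

theorem WithHighProbability.forall_mem_finset {k : ℕ} {κ : Type*} (s : Finset κ)
    {A : κ → ∀ n : ℕ, Set (BirthTimes k n)} (hA : ∀ α ∈ s, WithHighProbability k (A α)) :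
    WithHighProbability k fun n => {t | ∀ α ∈ s, t ∈ A α n} := by
  have h := tendsto_finsetSum s fun α hα => withHighProbability_iff.1 (hA α hα)
  rw [Finset.sum_const_zero] at h
  refine .of_le h (Eventually.of_forall fun n => ?_)
  refine (measureReal_mono ?_ (measure_ne_top _ _)).trans
    (measureReal_biUnion_finset_le s fun α => (A α n)ᶜ)
  intro t ht
  simp only [Set.mem_compl_iff, Set.mem_ofPred_eq, not_forall] at ht
  obtain ⟨α, hα, h⟩ := ht
  simp only [Set.mem_iUnion]
  exact ⟨α, hα, h⟩

theorem tendsto_log_natCast : Tendsto (fun n : ℕ => Real.log n) atTop atTop :=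
  Real.tendsto_log_atTop.comp tendsto_natCast_atTop_atTop

theorem tendsto_log_pow_div_natCast (r : ℕ) :
    Tendsto (fun n : ℕ => Real.log n ^ r / n) atTop (𝓝 0) :=
  (Real.isLittleO_pow_log_id_atTop (n := r)).tendsto_div_nhds_zero.comp tendsto_natCast_atTop_atTop

/-- The square root of `log n`, written as an exponential. -/
theorem tendsto_exp_half_log_log :
    Tendsto (fun n : ℕ => Real.exp (1 / 2 * Real.log (Real.log n))) atTop atTop :=
  Real.tendsto_exp_atTop.comp
    ((Real.tendsto_log_atTop.comp tendsto_log_natCast).const_mul_atTop (by norm_num))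

theorem exp_natCast_mul_log {n : ℕ} (hn : 0 < n) (u : ℕ) :
    Real.exp (u * Real.log n) = (n : ℝ) ^ u := by
  rw [Real.exp_nat_mul, Real.exp_log (by exact_mod_cast hn)]

theorem eventually_le_choose_sub (d r : ℕ) :
    ∀ᶠ n : ℕ in atTop, ((1 / 2) ^ r / r.factorial : ℝ) * (n : ℝ) ^ r ≤ ((n - d).choose r : ℕ) := by
  filter_upwards [eventually_ge_atTop (2 * (d + r))] with n hn
  refine le_trans ?_ (Nat.pow_le_choose r (n - d))
  rw [div_mul_eq_mul_div, ← mul_pow]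
  have h : (1 / 2 : ℝ) * n ≤ ((n - d + 1 - r : ℕ) : ℝ) := by
    have : n ≤ 2 * (n - d + 1 - r) := by omega
    have : (n : ℝ) ≤ 2 * ((n - d + 1 - r : ℕ) : ℝ) := by exact_mod_cast this
    linarith
  gcongr

/-- Pascal's rule iterated `m` times; together with the matching upper bound it pins down the order
of the difference of binomials in `numRivals`. -/
theorem choose_add_mul_le (N r m : ℕ) :
    N.choose (r + 1) + m * N.choose r ≤ (N + m).choose (r + 1) := by
  induction m with
  | zero => simp
  | succ m ih =>
    have h := Nat.choose_succ_succ (N + m) r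
    have h2 := Nat.choose_le_choose r (Nat.le_add_right N m)
    rw [← add_assoc, Nat.succ_mul]
    simp only [Nat.succ_eq_add_one] at h
    omega

theorem choose_le_add_mul (N r m : ℕ) :
    (N + m).choose (r + 1) ≤ N.choose (r + 1) + m * (N + m).choose r := by
  induction m with
  | zero => simp
  | succ m ih =>
    have h := Nat.choose_succ_succ (N + m) r
    have h2 := Nat.choose_le_choose r (Nat.le_succ (N + m))
    have h3 := Nat.mul_le_mul_left m h2
    rw [← add_assoc, Nat.succ_mul]
    simp only [Nat.succ_eq_add_one] at h h2 h3
    omega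

theorem numRivals_le {k n i : ℕ} (hi : i ≤ k) (hn : k + 1 ≤ n) :
    numRivals k n i ≤ (k + 1) * n ^ (k - i) := by
  have h := choose_le_add_mul (n - (k + 1)) (k - i) (k + 1 - i)
  rw [show n - (k + 1) + (k + 1 - i) = n - i by omega,
    show k - i + 1 = k + 1 - i by omega] at h
  have h1 : (n - i).choose (k - i) ≤ n ^ (k - i) :=
    (Nat.choose_le_choose _ (Nat.sub_le _ _)).trans (Nat.choose_le_pow _ _)
  have h2 := Nat.mul_le_mul (Nat.sub_le (k + 1) i) h1
  rw [numRivals]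
  omega

/-- Since `k + 1 - i ≥ 2`, the difference of binomials is at least twice the left side, and the
second copy absorbs the subtracted `1`. -/
theorem choose_le_numRivals {k n i : ℕ} (hi : i + 1 ≤ k) (hn : 2 * k + 1 ≤ n) :
    (n - (k + 1)).choose (k - i) ≤ numRivals k n i := by
  have h := choose_add_mul_le (n - (k + 1)) (k - i) (k + 1 - i)
  rw [show n - (k + 1) + (k + 1 - i) = n - i by omega,
    show k - i + 1 = k + 1 - i by omega] at h
  have h1 : 0 < (n - (k + 1)).choose (k - i) := Nat.choose_pos (by omega)
  have h2 := Nat.mul_le_mul_right ((n - (k + 1)).choose (k - i)) (show 2 ≤ k + 1 - i by omega)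
  rw [numRivals]
  omega

theorem exists_le_numRivals {k i : ℕ} (hi : i + 1 ≤ k) :
    ∃ c : ℝ, 0 < c ∧ ∀ᶠ n : ℕ in atTop, c * (n : ℝ) ^ (k - i) ≤ numRivals k n i := by
  refine ⟨(1 / 2) ^ (k - i) / (k - i).factorial, by positivity, ?_⟩
  filter_upwards [eventually_le_choose_sub (k + 1) (k - i), eventually_ge_atTop (2 * k + 1)]
    with n h hn
  exact h.trans (by exact_mod_cast choose_le_numRivals hi hn)

/-- The leading term `b m` must appear with constant `1`: at the end of a phase it exceeds a
multiple of `log n` only by `½ log log n`, so a constant factor in the exponent would be too costly.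
-/
theorem exp_le_one_sub_pow {b : ℝ} (hb : b ≤ 1 / 2) (m : ℕ) :
    Real.exp (-(b * m + 2 * (b * (b * m)))) ≤ (1 - b) ^ m := by
  have hpos : 0 < 1 - b := by linarith
  have h : Real.exp (-(b + 2 * b ^ 2)) ≤ 1 - b := by
    rw [← Real.le_log_iff_exp_le hpos]
    refine le_trans ?_ (Real.one_sub_inv_le_log_of_pos hpos)
    rw [← sub_nonneg]
    have : 1 - (1 - b)⁻¹ - -(b + 2 * b ^ 2) = b ^ 2 * (1 - 2 * b) / (1 - b) := by
      field_simp
      ring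
    rw [this]
    refine div_nonneg (mul_nonneg (sq_nonneg _) (by linarith)) hpos.le
  have h2 := pow_le_pow_left₀ (Real.exp_pos _).le h m
  rw [← Real.exp_nat_mul] at h2
  refine (le_of_eq (congrArg Real.exp ?_)).trans h2
  ring

theorem exp_neg_two_mul_le_one_sub_pow {a : ℝ} (ha0 : 0 ≤ a) (ha : a ≤ 1 / 2) (m : ℕ) :
    Real.exp (-(2 * (a * m))) ≤ (1 - a) ^ m := by
  have h2 := pow_le_pow_left₀ (Real.exp_pos _).le (exp_neg_two_mul_le ha0 ha) m
  rw [← Real.exp_nat_mul] at h2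
  refine (le_of_eq (congrArg Real.exp ?_)).trans h2
  ring

/-- If `b * numRivals` is at most of order `log n`, then `b` is of smaller order than
`n ^ (-(k - 1 - i)) / log n`. -/
theorem tendsto_of_mul_numRivals_le {k i : ℕ} (hi : i + 1 ≤ k) {b : ℕ → ℝ} {B : ℝ}
    (hb0 : ∀ᶠ n in atTop, 0 ≤ b n)
    (hb : ∀ᶠ n : ℕ in atTop, b n * numRivals k n i ≤ B * Real.log n) :
    Tendsto (fun n : ℕ => b n * (n : ℝ) ^ (k - 1 - i) * Real.log n) atTop (𝓝 0) := by
  obtain ⟨c, hc, hL⟩ := exists_le_numRivals hi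
  have h := (tendsto_log_pow_div_natCast 2).const_mul (B / c)
  rw [mul_zero] at h
  refine squeeze_zero' ?_ ?_ h
  · filter_upwards [hb0, tendsto_log_natCast.eventually_ge_atTop 0] with n h1 h2
    positivity
  · filter_upwards [hb0, hb, hL, tendsto_log_natCast.eventually_ge_atTop 0,
      eventually_gt_atTop 0] with n h1 h2 h3 h4 h5
    have hn : (0 : ℝ) < n := by exact_mod_cast h5
    have h6 : b n * (c * (n : ℝ) ^ (k - i)) ≤ B * Real.log n :=
      (mul_le_mul_of_nonneg_left h3 h1).trans h2
    rw [show k - i = k - 1 - i + 1 by omega, pow_succ] at h6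
    rw [div_mul_div_comm, le_div_iff₀ (by positivity)]
    calc b n * (n : ℝ) ^ (k - 1 - i) * Real.log n * (c * n)
        = b n * (c * ((n : ℝ) ^ (k - 1 - i) * n)) * Real.log n := by ring
      _ ≤ B * Real.log n * Real.log n := mul_le_mul_of_nonneg_right h6 h4
      _ = B * Real.log n ^ 2 := by ring

theorem tendsto_zero_of_mul_pow_mul_log {b : ℕ → ℝ} {r : ℕ} (hb0 : ∀ᶠ n in atTop, 0 ≤ b n)
    (h : Tendsto (fun n : ℕ => b n * (n : ℝ) ^ r * Real.log n) atTop (𝓝 0)) :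
    Tendsto (fun n : ℕ => b n * (n : ℝ) ^ r) atTop (𝓝 0) ∧
      Tendsto (fun n : ℕ => b n * Real.log n) atTop (𝓝 0) ∧ Tendsto b atTop (𝓝 0) := by
  have hlog := tendsto_log_natCast.eventually_ge_atTop 1
  have h1 : Tendsto (fun n : ℕ => b n * Real.log n) atTop (𝓝 0) := by
    refine squeeze_zero' ?_ ?_ h
    · filter_upwards [hb0, hlog] with n h1 h2
      positivity
    · filter_upwards [hb0, hlog, eventually_ge_atTop 1] with n h1 h2 h3
      have : (1 : ℝ) ≤ (n : ℝ) ^ r := one_le_pow₀ (by exact_mod_cast h3)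
      exact mul_le_mul_of_nonneg_right (le_mul_of_one_le_right h1 this) (by linarith)
  refine ⟨squeeze_zero' ?_ ?_ h, h1, squeeze_zero' hb0 ?_ h1⟩
  · filter_upwards [hb0] with n h1
    positivity
  · filter_upwards [hb0, hlog] with n h1 h2
    exact le_mul_of_one_le_right (by positivity) h2
  · filter_upwards [hb0, hlog] with n h1 h2
    exact le_mul_of_one_le_right h1 h2

theorem eventually_log_log_le :
    ∀ᶠ n : ℕ in atTop, 0 ≤ Real.log (Real.log n) ∧ Real.log (Real.log n) ≤ Real.log n := by
  filter_upwards [tendsto_log_natCast.eventually_ge_atTop 1] with n hn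
  exact ⟨Real.log_nonneg hn, (Real.log_le_sub_one_of_pos (by linarith)).trans (by linarith)⟩

/-- With high probability a single cell gives rise to a copy of `M_i` throughout `[a, b]`. -/
theorem withHighProbability_survivor {k i u : ℕ} (hi : i + 1 ≤ k) (hiu : i ≤ u) (hui : u ≤ i + 1)
    {a b : ℕ → ℝ} {α : ℝ} (hα : 0 < α)
    (ha : ∀ᶠ n : ℕ in atTop, α * Real.log n ≤ a n * (n : ℝ) ^ (k + 1 - u))
    (hab : ∀ᶠ n in atTop, a n ≤ b n)
    (hb : ∀ᶠ n : ℕ in atTop,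
      b n * numRivals k n i ≤ u * Real.log n + 1 / 2 * Real.log (Real.log n))
    (haL : ∀ᶠ n : ℕ in atTop, 2 * (a n * numRivals k n i) ≤ ((u - i : ℕ) : ℝ) * Real.log n + 2) :
    WithHighProbability k fun n =>
      {t | ∀ p, a n ≤ p → p ≤ b n → ContainsM k i (randomComplex t p)} := by
  have ha0 : ∀ᶠ n in atTop, 0 < a n := by
    filter_upwards [ha, tendsto_log_natCast.eventually_ge_atTop 1, eventually_gt_atTop 0]
      with n h1 h2 h3
    have hn : (0 : ℝ) < (n : ℝ) ^ (k + 1 - u) := pow_pos (by exact_mod_cast h3) _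
    have : 0 < a n * (n : ℝ) ^ (k + 1 - u) :=
      (mul_pos hα (by linarith : (0 : ℝ) < Real.log n)).trans_le h1
    exact (pos_iff_pos_of_mul_pos this).2 hn
  have hb0 : ∀ᶠ n in atTop, 0 ≤ b n := by
    filter_upwards [ha0, hab] with n h1 h2 using h1.le.trans h2
  have hbB : ∀ᶠ n : ℕ in atTop, b n * numRivals k n i ≤ (u + 1 : ℝ) * Real.log n := by
    filter_upwards [hb, eventually_log_log_le] with n h1 h2
    linarith [h2.1, h2.2]
  obtain ⟨hlim1, hlim2, hlim3⟩ := tendsto_zero_of_mul_pow_mul_log hb0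
    (tendsto_of_mul_numRivals_le hi hb0 hbB)
  have hb_half : ∀ᶠ n in atTop, b n ≤ 1 / 2 :=
    (hlim3.eventually (gt_mem_nhds (by norm_num : (0 : ℝ) < 1 / 2))).mono fun _ h => h.le
  -- The quadratic correction in `exp_le_one_sub_pow` costs at most a factor `exp 1`.
  have hbb : ∀ᶠ n : ℕ in atTop, 2 * (b n * (b n * numRivals k n i)) ≤ 1 := by
    have h := hlim2.const_mul (2 * (u + 1 : ℝ))
    rw [mul_zero] at h
    filter_upwards [hbB, hb0, h.eventually (gt_mem_nhds (zero_lt_one' ℝ))] with n h1 h2 h3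
    nlinarith [mul_le_mul_of_nonneg_left h1 h2]
  set c₀ : ℝ := (1 / 2) ^ (k + 1) / (k + 1).factorial with hc₀
  have hc₀pos : 0 < c₀ := by positivity
  have hNa : ∀ᶠ n : ℕ in atTop,
      c₀ * α * ((n : ℝ) ^ u * Real.log n) ≤ n.choose (k + 1) * a n := by
    filter_upwards [eventually_le_choose_sub 0 (k + 1), ha, ha0] with n h1 h2 h3
    rw [Nat.sub_zero] at h1
    calc c₀ * α * ((n : ℝ) ^ u * Real.log n) = c₀ * (n : ℝ) ^ u * (α * Real.log n) := by ring
      _ ≤ c₀ * (n : ℝ) ^ u * (a n * (n : ℝ) ^ (k + 1 - u)) := by gcongr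
      _ = c₀ * ((n : ℝ) ^ u * (n : ℝ) ^ (k + 1 - u)) * a n := by ring
      _ = c₀ * (n : ℝ) ^ (k + 1) * a n := by rw [← pow_add, Nat.add_sub_of_le (by omega)]
      _ ≤ n.choose (k + 1) * a n := by gcongr
  set μ : ℕ → ℝ := fun n => n.choose (k + 1) * (a n * (1 - b n) ^ numRivals k n i) with hμ
  -- The expected number of survivors is at least of order `n^u log n · n^(-u) (log n)^(-1/2)`,
  -- which is the square root of `log n`.
  have hμle : ∀ᶠ n : ℕ in atTop,
      c₀ * α * Real.exp (-1) * Real.exp (1 / 2 * Real.log (Real.log n)) ≤ μ n := by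
    filter_upwards [hNa, hb0, hb_half, hb, hbb, eventually_gt_atTop 0,
      tendsto_log_natCast.eventually_ge_atTop 1] with n h1 h2 h3 h4 h5 h6 h7
    have h8 := exp_le_one_sub_pow h3 (numRivals k n i)
    have h9 : Real.exp (-(u * Real.log n + 1 / 2 * Real.log (Real.log n) + 1)) ≤
        (1 - b n) ^ numRivals k n i := (Real.exp_le_exp.2 (by linarith)).trans h8
    have h10 := mul_le_mul h1 h9 (Real.exp_pos _).le
      (le_trans (by positivity) h1)
    have h11 : Real.log n = Real.exp (1 / 2 * Real.log (Real.log n)) *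
        Real.exp (1 / 2 * Real.log (Real.log n)) := by
      rw [← Real.exp_add, ← add_mul]
      norm_num
      rw [Real.exp_log (by linarith)]
    have h12 : c₀ * α * ((n : ℝ) ^ u * Real.log n) *
        Real.exp (-(u * Real.log n + 1 / 2 * Real.log (Real.log n) + 1)) =
        c₀ * α * Real.exp (-1) * Real.exp (1 / 2 * Real.log (Real.log n)) := by
      rw [show -(u * Real.log n + 1 / 2 * Real.log (Real.log n) + 1) =
        -(u * Real.log n) + -(1 / 2 * Real.log (Real.log n)) + -1 by ring, Real.exp_add,
        Real.exp_add, Real.exp_neg, Real.exp_neg, exp_natCast_mul_log h6]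
      nth_rewrite 1 [h11]
      have : (0 : ℝ) < (n : ℝ) ^ u := pow_pos (by exact_mod_cast h6) _
      field_simp
    rw [h12] at h10
    rw [hμ]
    linarith
  have hμ_top : Tendsto μ atTop atTop := tendsto_atTop_mono' _ hμle
    (tendsto_exp_half_log_log.const_mul_atTop (by positivity))
  -- The powers of `1 - b` cancel. What remains compares `n^i` with `n^u log n · (1 - a)^L`, and the
  -- hypothesis on `a` makes the latter at least of order `n^i log n`.
  have hratio : ∀ᶠ n : ℕ in atTop, 2 * (n.choose i *
      ((1 - b n) ^ numRivals k n i / (1 - a n) ^ numRivals k n i)) / μ n ≤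
      2 * Real.exp 2 / (c₀ * α) * (Real.log n)⁻¹ := by
    filter_upwards [hNa, ha0, hab, hb_half, haL, eventually_gt_atTop 0,
      tendsto_log_natCast.eventually_ge_atTop 1, hμ_top.eventually_gt_atTop 0]
      with n h1 h2 h3 h4 h5 h6 h7 h8
    have hn : (0 : ℝ) < n := by exact_mod_cast h6
    have h9 := exp_neg_two_mul_le_one_sub_pow h2.le (h3.trans h4) (numRivals k n i)
    have h10 : Real.exp (-(((u - i : ℕ) : ℝ) * Real.log n + 2)) ≤ (1 - a n) ^ numRivals k n i :=
      (Real.exp_le_exp.2 (by linarith)).trans h9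
    have h11 := mul_le_mul h1 h10 (Real.exp_pos _).le (le_trans (by positivity) h1)
    rw [neg_add, Real.exp_add, Real.exp_neg, Real.exp_neg, exp_natCast_mul_log h6] at h11
    have h12 : (n : ℝ) ^ u = (n : ℝ) ^ i * (n : ℝ) ^ (u - i) := by
      rw [← pow_add, Nat.add_sub_of_le hiu]
    have hq : 0 < 1 - b n := by linarith
    have hq' : 0 < 1 - a n := by linarith
    have hN : (n.choose i : ℝ) ≤ (n : ℝ) ^ i := by exact_mod_cast Nat.choose_le_pow n i
    have h13 : c₀ * α * ((n : ℝ) ^ i * Real.log n) * (Real.exp 2)⁻¹ ≤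
        n.choose (k + 1) * a n * (1 - a n) ^ numRivals k n i := by
      refine le_trans (le_of_eq ?_) h11
      rw [h12]
      field_simp
    have h14 : 2 * (n.choose i * ((1 - b n) ^ numRivals k n i / (1 - a n) ^ numRivals k n i)) /
        μ n = 2 * n.choose i / (n.choose (k + 1) * a n * (1 - a n) ^ numRivals k n i) := by
      have h15 : (n.choose (k + 1) : ℝ) ≠ 0 := by
        rintro h
        simp [hμ, h] at h8
      rw [hμ]
      have := (pow_pos hq (numRivals k n i)).ne'
      have := (pow_pos hq' (numRivals k n i)).ne'
      field_simp
    rw [h14]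
    have hlog : 0 < Real.log n := by linarith
    calc 2 * (n.choose i : ℝ) / (n.choose (k + 1) * a n * (1 - a n) ^ numRivals k n i)
        ≤ 2 * (n : ℝ) ^ i / (c₀ * α * ((n : ℝ) ^ i * Real.log n) * (Real.exp 2)⁻¹) := by
          gcongr
      _ = 2 * Real.exp 2 / (c₀ * α) * (Real.log n)⁻¹ := by
          field_simp
  have hc : ∀ n : ℕ, ∃ c : Finset (Fin n) → Finset (Fin n),
      ∀ K : Cell k n, c K.1 ⊆ K.1 ∧ (c K.1).card = i := by
    intro n
    have h : ∀ S : Finset (Fin n), ∃ C, i ≤ S.card → C ⊆ S ∧ C.card = i := by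
      intro S
      by_cases h : i ≤ S.card
      · obtain ⟨C, hC⟩ := Finset.exists_subset_card_eq h
        exact ⟨C, fun _ => hC⟩
      · exact ⟨∅, fun h' => absurd h' h⟩
    choose c hc using h
    exact ⟨c, fun K => hc K.1 (by rw [K.2]; omega)⟩
  choose c hc using hc
  have hI : Tendsto (fun n : ℕ => 2 * b n * ((k + 1) ^ 2 * n ^ (k - 1 - i) : ℕ)) atTop (𝓝 0) := by
    have h := hlim1.const_mul (2 * (k + 1 : ℝ) ^ 2)
    rw [mul_zero] at h
    refine h.congr fun n => ?_
    push_cast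
    ring
  have hε : Tendsto (fun n : ℕ => 4 / μ n +
      4 * (Real.exp (2 * b n * ((k + 1) ^ 2 * n ^ (k - 1 - i) : ℕ)) - 1) +
      2 * Real.exp 2 / (c₀ * α) * (Real.log n)⁻¹) atTop (𝓝 0) := by
    have h1 : Tendsto (fun n => 4 / μ n) atTop (𝓝 0) := tendsto_const_nhds.div_atTop hμ_top
    have h2 := ((Real.continuous_exp.tendsto 0).comp hI)
    have h3 := ((h2.sub_const 1).const_mul 4)
    have h4 := (tendsto_inv_atTop_zero.comp tendsto_log_natCast).const_mul
      (2 * Real.exp 2 / (c₀ * α))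
    have h5 := (h1.add h3).add h4
    simpa using h5
  refine .of_le hε ?_
  filter_upwards [hratio, ha0, hab, hb_half, eventually_ge_atTop (k + 1)] with n h1 h2 h3 h4 h5
  refine le_trans (measureReal_mono ?_) ((measureReal_no_survivor_le hi h5 (c n) (hc n) h2 h3 h4
    (μ := μ n) rfl).trans (add_le_add le_rfl h1))
  intro t ht
  by_contra hcon
  simp only [Set.mem_ofPred_eq, not_forall, not_not] at hcon
  obtain ⟨K, ⟨hK1, hK2⟩, hJ⟩ := hcon
  exact ht fun p hap hpb =>
    containsM_of_survives (by omega) (hc n K).1 (hc n K).2 hK1 hK2 hJ hap hpb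

end Asymptotics

end RandomComplex

namespace RandomComplex

/-! ### The phases of the process -/

section Phases

/-- The end of the `i`-th phase of the process: isolated vertices exist up to the end of phase `0`,
and copies of `M_i` exist throughout phase `i ≥ 1`. -/
noncomputable def phaseEnd (k i n : ℕ) : ℝ :=
  if i = 0 then 1 / 4 * Real.log n / (n : ℝ) ^ k
  else ((i + 1 : ℕ) * Real.log n + 1 / 2 * Real.log (Real.log n)) / numRivals k n i

/-- An intermediate time in the `i`-th phase. -/
noncomputable def phaseMid (k i n : ℕ) : ℝ := 1 / 2 * Real.log n / numRivals k n i

theorem eventually_numRivals_pos {k i : ℕ} (hi : i + 1 ≤ k) :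
    ∀ᶠ n : ℕ in atTop, (0 : ℝ) < numRivals k n i := by
  obtain ⟨c, hc, h⟩ := exists_le_numRivals hi
  filter_upwards [h, eventually_gt_atTop 0] with n h hn
  have : (0 : ℝ) < n := by exact_mod_cast hn
  exact lt_of_lt_of_le (by positivity) h

theorem eventually_numRivals_le {k i : ℕ} (hi : i ≤ k) :
    ∀ᶠ n : ℕ in atTop, (numRivals k n i : ℝ) ≤ (k + 1) * (n : ℝ) ^ (k - i) := by
  filter_upwards [eventually_ge_atTop (k + 1)] with n hn
  exact_mod_cast numRivals_le hi hn

/-- Puts phase `0` and the later phases on the same footing: the end of phase `i` has order `log n /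
n^(k-i)`. -/
theorem exists_phaseEnd_bounds {k i : ℕ} (hi : i + 1 ≤ k) :
    ∃ α B : ℝ, 0 < α ∧ ∀ᶠ n : ℕ in atTop,
      α * Real.log n ≤ phaseEnd k i n * (n : ℝ) ^ (k - i) ∧
        phaseEnd k i n * (n : ℝ) ^ (k - i) ≤ B * Real.log n := by
  rcases Nat.eq_zero_or_pos i with rfl | h0
  · refine ⟨1 / 4, 1 / 4, by norm_num, ?_⟩
    filter_upwards [eventually_gt_atTop 0] with n hn
    have : (0 : ℝ) < (n : ℝ) ^ k := pow_pos (by exact_mod_cast hn) _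
    rw [phaseEnd, if_pos rfl, Nat.sub_zero, div_mul_cancel₀ _ this.ne']
    exact ⟨le_rfl, le_rfl⟩
  · obtain ⟨c, hc, h⟩ := exists_le_numRivals hi
    refine ⟨1 / (k + 1), (i + 2) / c, by positivity, ?_⟩
    filter_upwards [h, eventually_numRivals_le (show i ≤ k by omega), eventually_numRivals_pos hi,
      eventually_log_log_le, tendsto_log_natCast.eventually_ge_atTop 0] with n h1 h2 h3 h4 h5
    rw [phaseEnd, if_neg h0.ne', div_mul_eq_mul_div _ (numRivals k n i : ℝ), le_div_iff₀ h3,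
      div_le_iff₀ h3]
    push_cast
    have hp : (0 : ℝ) ≤ (n : ℝ) ^ (k - i) := by positivity
    have hi0 : (0 : ℝ) ≤ i := Nat.cast_nonneg i
    constructor
    · calc 1 / ((k : ℝ) + 1) * Real.log n * numRivals k n i
          ≤ 1 / ((k : ℝ) + 1) * Real.log n * ((k + 1) * (n : ℝ) ^ (k - i)) := by gcongr
        _ = Real.log n * (n : ℝ) ^ (k - i) := by field_simp
        _ ≤ ((i + 1) * Real.log n + 1 / 2 * Real.log (Real.log n)) * (n : ℝ) ^ (k - i) := by
            refine mul_le_mul_of_nonneg_right ?_ hp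
            nlinarith [h4.1]
    · calc ((i + 1) * Real.log n + 1 / 2 * Real.log (Real.log n)) * (n : ℝ) ^ (k - i)
          ≤ ((i + 2) * Real.log n) * (n : ℝ) ^ (k - i) := by
            refine mul_le_mul_of_nonneg_right ?_ hp
            nlinarith [h4.1, h4.2]
        _ = (i + 2) / c * Real.log n * (c * (n : ℝ) ^ (k - i)) := by field_simp
        _ ≤ (i + 2) / c * Real.log n * numRivals k n i := by gcongr

theorem eventually_phaseEnd_pos {k i : ℕ} (hi : i + 1 ≤ k) :
    ∀ᶠ n : ℕ in atTop, 0 < phaseEnd k i n := by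
  obtain ⟨α, B, hα, h⟩ := exists_phaseEnd_bounds hi
  filter_upwards [h, tendsto_log_natCast.eventually_ge_atTop 1, eventually_gt_atTop 0]
    with n h1 h2 h3
  have hn : (0 : ℝ) < (n : ℝ) ^ (k - i) := pow_pos (by exact_mod_cast h3) _
  have h4 : 0 < phaseEnd k i n * (n : ℝ) ^ (k - i) :=
    (mul_pos hα (by linarith : (0 : ℝ) < Real.log n)).trans_le h1.1
  exact (pos_iff_pos_of_mul_pos h4).2 hn

/-- Phase `i` ends long before rivals become relevant on the scale `n^(-(k-i-1))` of the next phase.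
-/
theorem tendsto_phaseEnd_mul_pow {k i : ℕ} (hi : i + 1 ≤ k) :
    Tendsto (fun n : ℕ => phaseEnd k i n * (n : ℝ) ^ (k - i - 1)) atTop (𝓝 0) := by
  obtain ⟨α, B, hα, h⟩ := exists_phaseEnd_bounds hi
  have hlim := (tendsto_log_pow_div_natCast 1).const_mul B
  rw [mul_zero] at hlim
  refine squeeze_zero' ?_ ?_ hlim
  · filter_upwards [eventually_phaseEnd_pos hi] with n h
    positivity
  · filter_upwards [h, eventually_gt_atTop 0] with n h1 h2
    have hn : (0 : ℝ) < n := by exact_mod_cast h2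
    rw [pow_one, ← mul_div_assoc, le_div_iff₀ hn, mul_assoc, ← pow_succ,
      Nat.sub_add_cancel (by omega)]
    exact h1.2

theorem tendsto_phaseEnd {k i : ℕ} (hi : i + 1 ≤ k) :
    Tendsto (phaseEnd k i) atTop (𝓝 0) := by
  refine squeeze_zero' ?_ ?_ (tendsto_phaseEnd_mul_pow hi)
  · filter_upwards [eventually_phaseEnd_pos hi] with n h using h.le
  · filter_upwards [eventually_phaseEnd_pos hi, eventually_ge_atTop 1] with n h1 h2
    exact le_mul_of_one_le_right h1.le (one_le_pow₀ (by exact_mod_cast h2))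

/-- With the constant `1 / 4` the expected number of isolated vertices is at least `n^(1/2)`, and
two vertices have only `O(n^(k-1))` cells in common, so the second moment bound applies. -/
theorem withHighProbability_isolated {k : ℕ} (hk : 1 ≤ k) :
    WithHighProbability k fun n =>
      {t | ∀ p ≤ phaseEnd k 0 n, ∃ v, IsIsolatedVertex (randomComplex t p) v} := by
  set μ : ℕ → ℝ := fun n => n * (1 - phaseEnd k 0 n) ^ (n - 1).choose k with hμ
  have hhalf : ∀ᶠ n in atTop, phaseEnd k 0 n ≤ 1 / 2 :=
    ((tendsto_phaseEnd hk).eventually (gt_mem_nhds (by norm_num : (0 : ℝ) < 1 / 2))).mono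
      fun _ h => h.le
  have hμ_top : Tendsto μ atTop atTop := by
    refine tendsto_atTop_mono' _ ?_ (Real.tendsto_exp_atTop.comp
      (tendsto_log_natCast.const_mul_atTop (by norm_num : (0 : ℝ) < 1 / 2)))
    filter_upwards [hhalf, eventually_phaseEnd_pos hk, eventually_gt_atTop 0] with n h1 h2 h3
    have hn : (0 : ℝ) < n := by exact_mod_cast h3
    have hchoose : ((n - 1).choose k : ℝ) ≤ (n : ℝ) ^ k := by
      exact_mod_cast (Nat.choose_le_choose k (Nat.sub_le n 1)).trans (Nat.choose_le_pow n k)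
    have h4 : phaseEnd k 0 n * (n : ℝ) ^ k = 1 / 4 * Real.log n := by
      rw [phaseEnd, if_pos rfl, div_mul_cancel₀ _ (pow_pos hn k).ne']
    have h5 := mul_le_mul_of_nonneg_left hchoose h2.le
    have h6 := exp_neg_two_mul_le_one_sub_pow h2.le h1 ((n - 1).choose k)
    calc Real.exp (1 / 2 * Real.log n)
        = n * Real.exp (-(1 / 2 * Real.log n)) := by
          nth_rewrite 2 [← Real.exp_log hn]
          rw [← Real.exp_add]
          congr 1
          ring
      _ ≤ n * Real.exp (-(2 * (phaseEnd k 0 n * (n - 1).choose k))) := by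
          refine mul_le_mul_of_nonneg_left (Real.exp_le_exp.2 ?_) hn.le
          linarith
      _ ≤ μ n := mul_le_mul_of_nonneg_left h6 hn.le
  have hI : Tendsto (fun n : ℕ => 2 * phaseEnd k 0 n * (n ^ (k - 1) : ℕ)) atTop (𝓝 0) := by
    have h := (tendsto_phaseEnd_mul_pow hk).const_mul 2
    rw [mul_zero] at h
    refine h.congr fun n => ?_
    push_cast
    rw [Nat.sub_zero]
    ring
  have hε : Tendsto (fun n : ℕ => 4 / μ n +
      4 * (Real.exp (2 * phaseEnd k 0 n * (n ^ (k - 1) : ℕ)) - 1)) atTop (𝓝 0) := by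
    have h1 : Tendsto (fun n => 4 / μ n) atTop (𝓝 0) := tendsto_const_nhds.div_atTop hμ_top
    have h2 := (((Real.continuous_exp.tendsto 0).comp hI).sub_const 1).const_mul 4
    simpa using h1.add h2
  refine .of_le hε ?_
  filter_upwards [hhalf, eventually_phaseEnd_pos hk, eventually_ge_atTop 1] with n h1 h2 h3
  refine le_trans (measureReal_mono ?_) (measureReal_no_isolated_le hk h3 h2.le h1 (μ := μ n) rfl)
  intro t ht v hv
  exact ht fun p hp => ⟨v, isIsolatedVertex_of_forall fun K hK => hp.trans_lt (hv K hK)⟩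

/-- One survivor does not reach across the phase: too few cells are born by its start for one to
keep its rivals unborn until its end. A first survivor lasts to `phaseMid`, and a second one, from
the larger supply of cells born by then, lasts to the end. -/
theorem withHighProbability_phase {k i : ℕ} (hi : i + 2 ≤ k) :
    WithHighProbability k fun n => {t | ∀ p, phaseEnd k i n ≤ p → p ≤ phaseEnd k (i + 1) n →
      ContainsM k (i + 1) (randomComplex t p)} := by
  have hpos := eventually_numRivals_pos (show i + 1 + 1 ≤ k by omega)
  have hlog := tendsto_log_natCast.eventually_ge_atTop 2
  obtain ⟨α, B, hα, hαB⟩ := exists_phaseEnd_bounds (show i + 1 ≤ k by omega)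
  -- At the start of the phase the expected number of born rivals is at most `1`, which is why `u`
  -- equals the centre size for the first survivor. At `phaseMid` it is `½ log n`, which is paid for
  -- by raising `u` by one.
  have hsmall : ∀ᶠ n : ℕ in atTop, phaseEnd k i n * numRivals k n (i + 1) ≤ 1 := by
    have h := (tendsto_phaseEnd_mul_pow (show i + 1 ≤ k by omega)).const_mul (k + 1 : ℝ)
    rw [mul_zero] at h
    filter_upwards [h.eventually (gt_mem_nhds (zero_lt_one' ℝ)),
      eventually_numRivals_le (show i + 1 ≤ k by omega),
      eventually_phaseEnd_pos (show i + 1 ≤ k by omega)] with n h1 h2 h3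
    rw [← Nat.sub_sub] at h2
    nlinarith [mul_le_mul_of_nonneg_left h2 h3.le]
  have hmid : ∀ᶠ n : ℕ in atTop, phaseMid k (i + 1) n * numRivals k n (i + 1) =
      1 / 2 * Real.log n := by
    filter_upwards [hpos] with n h
    rw [phaseMid, div_mul_cancel₀ _ h.ne']
  have hend : ∀ᶠ n : ℕ in atTop, phaseEnd k (i + 1) n * numRivals k n (i + 1) =
      (i + 1 + 1 : ℕ) * Real.log n + 1 / 2 * Real.log (Real.log n) := by
    filter_upwards [hpos] with n h
    rw [phaseEnd, if_neg (by omega), div_mul_cancel₀ _ h.ne']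
  have h1 := withHighProbability_survivor (k := k) (i := i + 1) (u := i + 1) (a := phaseEnd k i)
    (b := phaseMid k (i + 1)) (by omega) le_rfl (by omega) hα (hαB.mono fun n h => by
      rw [show k + 1 - (i + 1) = k - i by omega]
      exact h.1)
    (by
      filter_upwards [hsmall, hmid, hpos, hlog] with n h1 h2 h3 h4
      exact le_of_mul_le_mul_right (by linarith) h3)
    (by
      filter_upwards [hmid, eventually_log_log_le, hlog] with n h1 h2 h3
      rw [h1]
      push_cast
      have : (0 : ℝ) ≤ i := Nat.cast_nonneg i
      nlinarith [h2.1])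
    (by
      filter_upwards [hsmall] with n h
      simp
      linarith)
  have h2 := withHighProbability_survivor (k := k) (i := i + 1) (u := i + 2)
    (a := phaseMid k (i + 1)) (b := phaseEnd k (i + 1)) (α := 1 / (2 * (k + 1))) (by omega)
    (by omega) (by omega) (by positivity)
    (by
      filter_upwards [hpos, eventually_numRivals_le (show i + 1 ≤ k by omega), hlog]
        with n h1 h2 h3
      rw [show k + 1 - (i + 2) = k - (i + 1) by omega, phaseMid,
        div_mul_eq_mul_div _ (numRivals k n (i + 1) : ℝ), le_div_iff₀ h1]
      calc 1 / (2 * ((k : ℝ) + 1)) * Real.log n * numRivals k n (i + 1)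
          ≤ 1 / (2 * ((k : ℝ) + 1)) * Real.log n * ((k + 1) * (n : ℝ) ^ (k - (i + 1))) := by gcongr
        _ = 1 / 2 * Real.log n * (n : ℝ) ^ (k - (i + 1)) := by field_simp)
    (by
      filter_upwards [hmid, hend, hpos, hlog, eventually_log_log_le] with n h1 h2 h3 h4 h5
      refine le_of_mul_le_mul_right ?_ h3
      rw [h1, h2]
      push_cast
      have : (0 : ℝ) ≤ i := Nat.cast_nonneg i
      nlinarith [h5.1])
    (hend.mono fun n h => h.le)
    (by
      filter_upwards [hmid] with n h
      rw [h, show i + 2 - (i + 1) = 1 by omega]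
      push_cast
      linarith)
  refine (h1.inter h2).mono (Eventually.of_forall ?_)
  rintro n t ⟨ht1, ht2⟩ p hp1 hp2
  rcases le_total p (phaseMid k (i + 1) n) with h | h
  · exact ht1 p hp1 h
  · exact ht2 p h hp2

/-- The union bound is of order `n^(k+1) · n^(-(k-j)) · n^(-(j+1)) (log n)^(-1/2)`: the powers of
`n` cancel, and the term `½ log log n` in `phaseEnd` makes it vanish. -/
theorem withHighProbability_not_late {k j : ℕ} (hj : 1 ≤ j) (hjk : j + 1 ≤ k) :
    WithHighProbability k fun n => {t | ∀ (K : Cell k n) (C : Finset (Fin n)), C ⊆ K.1 →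
      C.card = j → (∀ K' ∈ rivals k K.1 C, (t K : ℝ) < (t K' : ℝ)) →
        (t K : ℝ) ≤ phaseEnd k j n} := by
  obtain ⟨c, hc, hL⟩ := exists_le_numRivals hjk
  have hε := (tendsto_inv_atTop_zero.comp tendsto_exp_half_log_log).const_mul
    (2 ^ (k + 1) * (2 / c))
  rw [mul_zero] at hε
  refine .of_le hε ?_
  filter_upwards [hL, eventually_numRivals_pos hjk, eventually_phaseEnd_pos hjk,
    eventually_gt_atTop 0] with n h1 h2 h3 h4
  have hn : (0 : ℝ) < n := by exact_mod_cast h4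
  refine le_trans (measureReal_mono ?_) ((measureReal_late_le (k := k) (n := n) (i := j)
    (by omega) (by exact_mod_cast h2) h3.le).trans ?_)
  · intro t ht
    simp only [Set.mem_compl_iff, Set.mem_ofPred_eq, not_forall, not_le] at ht
    obtain ⟨K, C, hC, hCj, hr, hlt⟩ := ht
    exact ⟨K, C, hC, hCj, hlt, hr⟩
  · have hT : phaseEnd k j n * numRivals k n j =
        (j + 1 : ℕ) * Real.log n + 1 / 2 * Real.log (Real.log n) := by
      rw [phaseEnd, if_neg (by omega), div_mul_cancel₀ _ h2.ne']
    rw [hT, neg_add, Real.exp_add, Real.exp_neg, Real.exp_neg, exp_natCast_mul_log h4]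
    have hN : (n.choose (k + 1) : ℝ) ≤ (n : ℝ) ^ (k + 1) := by
      exact_mod_cast Nat.choose_le_pow n (k + 1)
    have hpow : (n : ℝ) ^ (k + 1) = (n : ℝ) ^ (k - j) * (n : ℝ) ^ (j + 1) := by
      rw [← pow_add]
      congr 1
      omega
    calc (n.choose (k + 1) : ℝ) * (2 ^ (k + 1) * (2 / numRivals k n j *
          (((n : ℝ) ^ (j + 1))⁻¹ * (Real.exp (1 / 2 * Real.log (Real.log n)))⁻¹)))
        ≤ (n : ℝ) ^ (k + 1) * (2 ^ (k + 1) * (2 / (c * (n : ℝ) ^ (k - j)) *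
          (((n : ℝ) ^ (j + 1))⁻¹ * (Real.exp (1 / 2 * Real.log (Real.log n)))⁻¹))) := by gcongr
      _ = 2 ^ (k + 1) * (2 / c) * (Real.exp (1 / 2 * Real.log (Real.log n)))⁻¹ := by
          rw [hpow]
          field_simp

theorem withHighProbability_cone {k j : ℕ} (hjk : j + 1 ≤ k) :
    WithHighProbability k fun n => {t | ∀ (K : Cell k n) (S : Finset (Fin n)), S ⊆ K.1 →
      S.card = j + 1 → ∃ a ∉ K.1, ∀ U ⊆ S, U.card = j →
        ∃ K' : Cell k n, insert a U ⊆ K'.1 ∧ (t K' : ℝ) ≤ phaseEnd k j n} := by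
  obtain ⟨α, B, hα, hαB⟩ := exists_phaseEnd_bounds hjk
  set c : ℝ := (1 / 2) ^ (k - j) / (k - j).factorial with hc_def
  have hc : 0 < c := by positivity
  -- Each apex fails with probability at most a negative power of `n`; this many apexes bring the
  -- exponential factor down to `n^(-(k+2))`, which beats the `n^(k+1)` cells.
  obtain ⟨m, hm⟩ := exists_nat_ge ((k + 2 : ℕ) / (α * c))
  rw [div_le_iff₀ (by positivity)] at hm
  have hε := (tendsto_inv_atTop_zero.comp (tendsto_natCast_atTop_atTop (R := ℝ))).const_mul
    ((2 : ℝ) ^ (k + 1) * (j + 1) ^ m)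
  rw [mul_zero] at hε
  refine .of_le hε ?_
  filter_upwards [hαB, eventually_le_choose_sub (j + m) (k - j), eventually_phaseEnd_pos hjk,
    (tendsto_phaseEnd hjk).eventually (gt_mem_nhds (zero_lt_one' ℝ)), eventually_gt_atTop 0,
    eventually_ge_atTop (k + 1 + m), tendsto_log_natCast.eventually_ge_atTop 0]
    with n h1 h2 h3 h4 h5 h6 h7
  have hn : (0 : ℝ) < n := by exact_mod_cast h5
  refine le_trans (measureReal_mono ?_) ((measureReal_no_cone_le (k := k) (n := n) (i := j) (m := m)
    (by omega) h6 h3.le h4.le).trans ?_)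
  · intro t ht
    simp only [Set.mem_compl_iff, Set.mem_ofPred_eq, not_forall, not_exists, not_and, not_le] at ht
    obtain ⟨K, S, hS, hSj, h⟩ := ht
    refine ⟨K, S, hS, hSj, fun a ha => ?_⟩
    obtain ⟨U, hU, hUj, hr⟩ := h a ha
    exact ⟨U, hU, hUj, hr⟩
  · have hN : (n.choose (k + 1) : ℝ) ≤ (n : ℝ) ^ (k + 1) := by
      exact_mod_cast Nat.choose_le_pow n (k + 1)
    have hexp : ((k + 2 : ℕ) : ℝ) * Real.log n ≤
        phaseEnd k j n * (m * (n - j - m).choose (k - j) : ℕ) := by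
      rw [Nat.sub_sub]
      push_cast at hm ⊢
      calc ((k : ℝ) + 2) * Real.log n ≤ m * (α * c) * Real.log n := by gcongr
        _ = m * c * (α * Real.log n) := by ring
        _ ≤ m * c * (phaseEnd k j n * (n : ℝ) ^ (k - j)) :=
            mul_le_mul_of_nonneg_left h1.1 (by positivity)
        _ = phaseEnd k j n * (m * (c * (n : ℝ) ^ (k - j))) := by ring
        _ ≤ phaseEnd k j n * (m * (n - (j + m)).choose (k - j)) := by gcongr
    calc (n.choose (k + 1) : ℝ) * (2 ^ (k + 1) * (((j : ℝ) + 1) ^ m *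
          Real.exp (-(phaseEnd k j n * (m * (n - j - m).choose (k - j) : ℕ)))))
        ≤ (n : ℝ) ^ (k + 1) * (2 ^ (k + 1) * (((j : ℝ) + 1) ^ m *
          Real.exp (-((k + 2 : ℕ) * Real.log n)))) := by gcongr
      _ = 2 ^ (k + 1) * (j + 1) ^ m * (n : ℝ)⁻¹ := by
          rw [Real.exp_neg, exp_natCast_mul_log h5, pow_succ (n : ℝ) (k + 1)]
          field_simp

/-- After the end of phase `j`, copies of `M_j` persist until the last one disappears. -/
theorem withHighProbability_final {k j : ℕ} (hj : 1 ≤ j) (hjk : j + 1 ≤ k) :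
    WithHighProbability k fun n => {t | ∀ p, phaseEnd k j n ≤ p → 0 ≤ p → p < lastM j t →
      ContainsM k j (randomComplex t p)} := by
  refine ((withHighProbability_not_late hj hjk).inter (withHighProbability_cone hjk)).mono
    (Eventually.of_forall ?_)
  rintro n t ⟨hlate, hcone⟩ p hp hp0 hlt
  -- For the empty set the supremum is `0`, which contradicts `0 ≤ p < lastM j t`.
  have hne : {p : ℝ | p ∈ Set.Icc (0 : ℝ) 1 ∧ ContainsM k j (randomComplex t p)}.Nonempty := by
    rw [Set.nonempty_iff_ne_empty]
    intro h
    rw [lastM, h, Real.sSup_empty] at hlt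
    linarith
  obtain ⟨q, ⟨-, hq⟩, hpq⟩ := exists_lt_of_lt_csSup hne hlt
  obtain ⟨K, C, hCK, hC, hK, hr⟩ := exists_cell_of_containsM (by omega) hq
  -- The cell is born by `q` and its rivals after `q`, so it precedes all of them and must have been
  -- born by the end of phase `j`.
  have hKT := hlate K C hCK hC fun K' hK' => hK.trans_lt (hr K' hK')
  refine containsM_of_survives (by omega) hCK hC hKT hr ?_ hp hpq.le
  refine hasCrossingCycle_of_cone (mem_complexOf (mem_bornBy.2 hKT)) ?_ hC fun S hS hSj => ?_
  · refine hCK.ssubset_of_ne fun h => ?_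
    have := K.2
    rw [← h, hC] at this
    omega
  · obtain ⟨a, ha, h⟩ := hcone K S hS hSj
    refine ⟨a, ha, fun U hU hUj => ?_⟩
    obtain ⟨K', hK', hle⟩ := h U hU hUj
    exact subset_mem_complexOf (mem_bornBy.2 hle) (Finset.insert_nonempty _ _) hK'

end Phases

end RandomComplex

theorem mainTheorem4 (k : ℕ) (hk : 2 ≤ k) (j : ℕ) (hj : 1 ≤ j) (hjk : j ≤ k - 1) :
    RandomComplex.WithHighProbability k (fun n =>
      {t : RandomComplex.BirthTimes k n |
        ∀ p : ℝ, 0 ≤ p → p < RandomComplex.lastM j t →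
          (∃ v : Fin n, RandomComplex.IsIsolatedVertex (RandomComplex.randomComplex t p) v) ∨
          ∃ i ∈ Finset.Icc 1 j, RandomComplex.ContainsM k i (RandomComplex.randomComplex t p)}) := by
  have hphases := RandomComplex.WithHighProbability.forall_mem_finset (Finset.range j)
    fun i hi => RandomComplex.withHighProbability_phase (k := k) (i := i) (by
      have := Finset.mem_range.1 hi
      omega)
  refine (((RandomComplex.withHighProbability_isolated (by omega)).inter hphases).inter
    (RandomComplex.withHighProbability_final hj (by omega))).mono (Eventually.of_forall ?_)
  rintro n t ⟨⟨hiso, hph⟩, hfin⟩ p hp0 hlt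
  by_cases hj' : RandomComplex.phaseEnd k j n ≤ p
  · exact Or.inr ⟨j, Finset.mem_Icc.2 ⟨hj, le_rfl⟩, hfin p hj' hp0 hlt⟩
  · have hex : ∃ i, p ≤ RandomComplex.phaseEnd k i n := ⟨j, (not_le.1 hj').le⟩
    classical
    -- Taking the first phase that ends no earlier than `p` places `p` after the end of the
    -- preceding phase, without any need for monotonicity of `phaseEnd`.
    rcases Nat.eq_zero_or_pos (Nat.find hex) with h0 | hpos
    · refine Or.inl (hiso p ?_)
      have := Nat.find_spec hex
      rwa [h0] at this
    · obtain ⟨i, hi⟩ := Nat.exists_eq_succ_of_ne_zero hpos.ne'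
      have hspec := Nat.find_spec hex
      rw [hi] at hspec
      have hmin := Nat.find_min hex (m := i) (by omega)
      have hle : Nat.find hex ≤ j := Nat.find_min' hex (not_le.1 hj').le
      exact Or.inr ⟨i + 1, Finset.mem_Icc.2 ⟨by omega, by omega⟩,
        hph i (Finset.mem_range.2 (by omega)) p (not_le.1 hmin).le hspec⟩
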